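/- Let $a(n)$ ($n\ge 0$) and $b(n)$ ($n\ge 1$) be real numbers with $a(0)=1$, $a(n)\neq 0$ for all $n$, and $\sum_{n\ge 1}|a(n)|^{-1}=\infty$. Let $H_+$ be the self-adjoint half-line Jacobi operator on $\ell^2(\mathbb{Z}_+)$, $\mathbb{Z}_+=\{1,2,\dots\}$, with Dirichlet boundary condition: $$(H_+u)(n)=a(n)u(n+1)+a(n-1)u(n-1)+b(n)u(n),\qquad n\ge 1,\quad u(0)=0,$$ on the domain of all $u\in\ell^2(\mathbb{Z}_+)$ for which the right-hand side is in $\ell^2(\mathbb{Z}_+)$. Let $\mu^+$ be the spectral measure of $H_+$ at $\delta_1$, that is, the finite Borel measure on $\mathbb{R}$ with $\langle (H_+-z)^{-1}\delta_1,\delta_1\rangle=\int_{\mathbb{R}}\frac{d\mu^+(x)}{x-z}$ for all $z\in\mathbb{C}\setminus\mathbb{R}$. For $L\ge 0$ and a function $\phi$ on $\mathbb{Z}_+$ put $$\|\phi\|_L^2=\sum_{n=1}^{\lfloor L\rfloor}|\phi(n)|^2+(L-\lfloor L\rfloor)\,|\phi(\lfloor L\rfloor+1)|^2 .$$ For $E,\theta\in\mathbb{R}$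 let $u_\theta(n,E)$, $n\ge 0$, be the solution of $a(n)u(n+1)+a(n-1)u(n-1)+b(n)u(n)=Eu(n)$ ($n\ge 1$) with $u_\theta(0,E)=\sin\theta$ and $u_\theta(1,E)=\cos\theta$. For $\epsilon>0$ let $L^+_\epsilon(E)$ be the unique $L\ge 0$ with $$\max_\theta\|u_\theta(\cdot,E)\|_{L}\cdot\min_\theta\|u_\theta(\cdot,E)\|_{L}=\epsilon^{-1}.$$ For a function $A$ of time and $T>0$ write $\langle A(t)\rangle_T=\frac{2}{T}\int_0^\infty e^{-2t/T}A(t)\,dt$. Theorem. There is a universal constant $C>0$ (independent of $a,b,T,L$) such that for all such $a,b$ and all $T>0$, $L>1$, $$\big\langle \|e^{-iH_+t}\delta_1\|_L^2\big\rangle_T> C\,\mu^+\big(\{E\in\mathbb{R}: L^+_{T^{-1}}(E)\le L\}\big).$$ -/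

import Mathlib

noncomputable section

namespace JacobiDynamics

/-! ### Evolution and spectral measures of operators in a Hilbert space -/

section General

variable {E : Type*} [NormedAddCommGroup E] [InnerProductSpace ℂ E]

/-- `U` is the strongly continuous one-parameter unitary group with infinitesimal generator `-iH`:
a vector `x` is in the domain of `H`, with `H x = y`, exactly when `t ↦ U t x` is differentiable
at `0` with derivative `-i y`. By Stone's theorem every self-adjoint `H` has exactly one such
group, namely `U t = e^{-iHt}`. -/
structure IsUnitaryGroupOf (H : E →ₗ.[ℂ] E) (U : ℝ → E →L[ℂ] E) : Prop where
  map_zero : U 0 = ContinuousLinearMap.id ℂ E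
  map_add : ∀ s t : ℝ, U (s + t) = (U s).comp (U t)
  norm_map : ∀ (t : ℝ) (x : E), ‖U t x‖ = ‖x‖
  continuous_orbit : ∀ x : E, Continuous fun t : ℝ => U t x
  generator : ∀ x y : E,
    (∃ hx : x ∈ H.domain, H ⟨x, hx⟩ = y) ↔
      HasDerivAt (fun t : ℝ => U t x) (-(Complex.I • y)) 0

open Classical in
/-- The propagator `e^{-iHt}` of a self-adjoint operator `H` (zero if `-iH` generates no unitary
group, which does not happen for self-adjoint `H`). -/
def propagator (H : E →ₗ.[ℂ] E) : ℝ → E →L[ℂ] E :=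
  if h : ∃ U, IsUnitaryGroupOf H U then h.choose else 0

/-- `μ` is the spectral measure of `H` at the vector `ψ`: a finite Borel measure on `ℝ` whose Borel
transform is `⟨(H - z)⁻¹ ψ, ψ⟩` for all non-real `z`. Here `φ = (H - z)⁻¹ ψ`, and Mathlib's inner
product is linear in its second argument. -/
structure IsSpectralMeasure (H : E →ₗ.[ℂ] E) (ψ : E) (μ : MeasureTheory.Measure ℝ) : Prop where
  finite : MeasureTheory.IsFiniteMeasure μ
  borelTransform : ∀ z : ℂ, z.im ≠ 0 →
    ∃ φ : H.domain, H φ - z • (φ : E) = ψ ∧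
      inner ℂ ψ (φ : E) = ∫ x : ℝ, ((x : ℂ) - z)⁻¹ ∂μ

open Classical in
/-- The spectral measure of a self-adjoint operator `H` at `ψ` (it exists and is unique for
self-adjoint `H`; zero if there is none). -/
def spectralMeasure (H : E →ₗ.[ℂ] E) (ψ : E) : MeasureTheory.Measure ℝ :=
  if h : ∃ μ, IsSpectralMeasure H ψ μ then h.choose else 0

end General

/-! ### The half-line Jacobi operator -/

/-- The Hilbert space `ℓ²(ℤ₊)`, where `ℤ₊ = {1, 2, 3, …}`. The coordinate with index `k : ℕ` is the
value at the site `k + 1`. -/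
abbrev HalfLine : Type := lp (fun _ : ℕ => ℂ) 2

/-- The function on the sites `0, 1, 2, …` given by a sequence of values at the sites `1, 2, …`,
continued by the Dirichlet condition: it vanishes at the site `0`. -/
def site (u : ℕ → ℂ) : ℕ → ℂ
  | 0 => 0
  | n + 1 => u n

/-- The vector `δ₁`, concentrated at the site `1`. -/
def delta1 : HalfLine := lp.single 2 0 1

/-- The Jacobi difference expression with the Dirichlet boundary condition,
`a(n) u(n+1) + a(n-1) u(n-1) + b(n) u(n)` at the site `n = k + 1`. -/
def jacobiExpr (a b : ℕ → ℝ) (u : ℕ → ℂ) (k : ℕ) : ℂ :=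
  a (k + 1) * site u (k + 2) + a k * site u k + b (k + 1) * site u (k + 1)

theorem jacobiExpr_add (a b : ℕ → ℝ) (u v : ℕ → ℂ) :
    jacobiExpr a b (u + v) = jacobiExpr a b u + jacobiExpr a b v := by
  funext k
  cases k <;> simp [jacobiExpr, site] <;> ring

theorem jacobiExpr_smul (a b : ℕ → ℝ) (c : ℂ) (u : ℕ → ℂ) :
    jacobiExpr a b (c • u) = c • jacobiExpr a b u := by
  funext k
  cases k <;> simp [jacobiExpr, site] <;> ring

/-- The half-line operator `H₊`: the Jacobi expression with the Dirichlet condition on its maximal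
domain, the `u ∈ ℓ²` that it maps into `ℓ²`. When `∑ 1/|a(n)| = ∞` this is the unique self-adjoint
operator given by the expression, the closure of its restriction to finitely supported vectors. -/
def halfLineOp (a b : ℕ → ℝ) : HalfLine →ₗ.[ℂ] HalfLine where
  domain :=
    { carrier := {u | Memℓp (jacobiExpr a b u) 2}
      add_mem' := by
        intro u v hu hv
        simp only [Set.mem_ofPred_eq, lp.coeFn_add, jacobiExpr_add] at hu hv ⊢
        exact hu.add hv
      zero_mem' := by
        have h : jacobiExpr a b (0 : ℕ → ℂ) = 0 := by
          simpa using jacobiExpr_smul a b 0 0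
        simp only [Set.mem_ofPred_eq, lp.coeFn_zero, h]
        exact zero_memℓp
      smul_mem' := by
        intro c u hu
        simp only [Set.mem_ofPred_eq, lp.coeFn_smul, jacobiExpr_smul] at hu ⊢
        exact hu.const_smul c }
  toFun :=
    { toFun := fun u => ⟨jacobiExpr a b u.1, u.2⟩
      map_add' := by
        intro u v
        ext k
        exact congrFun (jacobiExpr_add a b u.1 v.1) k
      map_smul' := by
        intro c u
        ext k
        exact congrFun (jacobiExpr_smul a b c u.1) k }

/-! ### Solutions, truncated norms, and the length scale -/

/-- The solution `u_θ(n, z)` of `a(n) u(n+1) + a(n-1) u(n-1) + b(n) u(n) = z u(n)`, `n ≥ 1`, with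
`u_θ(0, z) = sin θ` and `u_θ(1, z) = cos θ`. -/
def solution (a b : ℕ → ℝ) (θ : ℝ) (z : ℂ) : ℕ → ℂ
  | 0 => (Real.sin θ : ℂ)
  | 1 => (Real.cos θ : ℂ)
  | n + 2 =>
      ((z - b (n + 1)) * solution a b θ z (n + 1) - a n * solution a b θ z n) / a (n + 1)

/-- `‖φ‖²_L = ∑_{n=1}^{⌊L⌋} |φ(n)|² + (L - ⌊L⌋) |φ(⌊L⌋ + 1)|²` for real `L ≥ 0`. -/
def normSqL (φ : ℕ → ℂ) (L : ℝ) : ℝ :=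
  ∑ n ∈ Finset.Icc 1 ⌊L⌋₊, ‖φ n‖ ^ 2 + (L - ⌊L⌋₊) * ‖φ (⌊L⌋₊ + 1)‖ ^ 2

/-- The truncated norm `‖φ‖_L`. -/
def normL (φ : ℕ → ℂ) (L : ℝ) : ℝ := Real.sqrt (normSqL φ L)

/-- `max_θ ‖u_θ(·, E)‖_L · min_θ ‖u_θ(·, E)‖_L`; the supremum and the infimum are attained, since the
norm is a continuous and periodic function of `θ`. -/
def maxMinProduct (a b : ℕ → ℝ) (E L : ℝ) : ℝ :=
  (⨆ θ : ℝ, normL (solution a b θ E) L) * (⨅ θ : ℝ, normL (solution a b θ E) L)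

/-- The length scale `L⁺_ε(E)`: the `L ≥ 0` with `max_θ ‖u_θ‖_L · min_θ ‖u_θ‖_L = ε⁻¹`. When
`∑ 1/|a(n)| = ∞` there is exactly one such `L` for every `ε > 0`. -/
def lengthScale (a b : ℕ → ℝ) (ε E : ℝ) : ℝ :=
  sInf {L : ℝ | 0 ≤ L ∧ maxMinProduct a b E L = ε⁻¹}

/-- The time average `⟨A⟩_T = (2/T) ∫₀^∞ e^{-2t/T} A(t) dt`. -/
def timeAverage (T : ℝ) (A : ℝ → ℝ) : ℝ :=
  2 / T * ∫ t in Set.Ioi (0 : ℝ), Real.exp (-2 * t / T) * A t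

end JacobiDynamics

end

/-! The resolvent is the Laplace transform of the evolution. Plancherel therefore turns the time
average into `(2/T) ∫ ‖(H₊ - z)⁻¹δ₁‖²_L dξ` with `z = -2πξ + i/T`, and it remains to bound this
Green function `g` from below near the set `S` of energies `E` with `L⁺_{1/T}(E) ≤ L`.

Extended by `g(0) = -1`, `g` solves the difference equation at `z`. At `E ∈ S` and the scale `L' =
L⁺_{1/T}(E)`, take the solutions `u, v` of largest and smallest norm. They are orthogonal for
`‖·‖_{L'}`, have Wronskian 1, and their norms have product `T`. Let `cu - dv` be the solution at `E`
with the data of `g` at the sites 0 and 1. Variation of parameters (`normSqL_free_le`) gives `‖cu -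
dv‖² ≤ 18 ‖g‖²` for `|z - E|² ≤ 2/T²`. By orthogonality and the arithmetic-geometric mean
inequality, `‖cu - dv‖² ≥ 2T|c||d|`, and `|c||d| ≥ |Im(c d̄)| = |Im g(1)|`. Hence `‖g‖²_L ≥ (T/9) Im
g(1)` (`im_le_normSqL`).

Since `Im g(1)` is the Poisson integral of `μ⁺`, its integral in `ξ` over the `1/T`-neighbourhood of
`S` is at least `μ⁺(S)/(2π)` (`measure_le_lintegral_poisson`). Altogether the average is at least
`μ⁺(S)/(9π)`.

`propagator` and `spectralMeasure` are defined by choice, so their existence has to be proved.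
Divergence of `∑ 1/|a(n)|` makes `H₊` symmetric with `H₊ - is` onto. Stone's theorem then follows by
Yosida approximation, and the spectral measure comes from the functional calculus of the normal
operator `(H₊ - i)⁻¹`. -/

noncomputable section

open Filter Topology NormedSpace

namespace JacobiDynamics

/-! ### Unitary groups with bounded generators -/

section Stone

variable {E : Type*} [NormedAddCommGroup E] [InnerProductSpace ℂ E] [CompleteSpace E]

/-- The group `e^{-itA}` generated by a bounded operator `A`. -/
def boundedGroup (A : E →L[ℂ] E) (t : ℝ) : E →L[ℂ] E := exp (t • (-(Complex.I • A)))

theorem boundedGroup_zero (A : E →L[ℂ] E) : boundedGroup A 0 = 1 := by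
  simp [boundedGroup, NormedSpace.exp_zero]

theorem boundedGroup_add (A : E →L[ℂ] E) (s t : ℝ) :
    boundedGroup A (s + t) = boundedGroup A s * boundedGroup A t := by
  let _ : NormedAlgebra ℚ (E →L[ℂ] E) := NormedAlgebra.restrictScalars ℚ ℂ _
  rw [boundedGroup, add_smul, NormedSpace.exp_add_of_commute]
  · rfl
  · exact ((Commute.refl _).smul_left _).smul_right _

theorem boundedGroup_mem_unitary {A : E →L[ℂ] E} (hA : IsSelfAdjoint A) (t : ℝ) :
    boundedGroup A t ∈ unitary (E →L[ℂ] E) := by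
  let _ : NormedAlgebra ℚ (E →L[ℂ] E) := NormedAlgebra.restrictScalars ℚ ℂ _
  apply NormedSpace.exp_mem_unitary_of_mem_skewAdjoint
  rw [skewAdjoint.mem_iff]
  simp [star_smul, hA.star_eq]

theorem norm_boundedGroup_apply {A : E →L[ℂ] E} (hA : IsSelfAdjoint A) (t : ℝ) (x : E) :
    ‖boundedGroup A t x‖ = ‖x‖ :=
  ContinuousLinearMap.norm_map_of_mem_unitary (boundedGroup_mem_unitary hA t) x

theorem hasDerivAt_boundedGroup_apply (A : E →L[ℂ] E) (t : ℝ) (x : E) :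
    HasDerivAt (fun s => boundedGroup A s x) (-(Complex.I • boundedGroup A t (A x))) t := by
  have h := hasDerivAt_exp_smul_const (𝕂 := ℝ) (-(Complex.I • A)) t
  have h2 := ((ContinuousLinearMap.apply ℂ E x).restrictScalars ℝ).hasFDerivAt.comp_hasDerivAt t h
  have e : (exp (t • -(Complex.I • A)) * -(Complex.I • A)) x
      = -(Complex.I • boundedGroup A t (A x)) := by
    simp [boundedGroup]
  rw [← e]
  exact h2

theorem norm_boundedGroup_sub_le {A : E →L[ℂ] E} (hA : IsSelfAdjoint A) (t : ℝ) (x : E) :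
    ‖boundedGroup A t x - x‖ ≤ |t| * ‖A x‖ := by
  have h := Convex.norm_image_sub_le_of_norm_hasDerivWithin_le (𝕜 := ℝ) (s := Set.univ)
    (f := fun s => boundedGroup A s x) (x := 0) (y := t) (C := ‖A x‖)
    (fun s _ => (hasDerivAt_boundedGroup_apply A s x).hasDerivWithinAt)
    (fun s _ => by rw [norm_neg, norm_smul, norm_boundedGroup_apply hA]; simp)
    convex_univ trivial trivial
  simpa [boundedGroup_zero, mul_comm] using h

/-- Commutation factors one group as the other times the group of `A - B`, so the error depends only
on `A x - B x`, not on the norms of `A` and `B`. -/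
theorem norm_boundedGroup_sub_boundedGroup_le {A B : E →L[ℂ] E} (hA : IsSelfAdjoint A)
    (hB : IsSelfAdjoint B) (hAB : Commute A B) (t : ℝ) (x : E) :
    ‖boundedGroup A t x - boundedGroup B t x‖ ≤ |t| * ‖A x - B x‖ := by
  let _ : NormedAlgebra ℚ (E →L[ℂ] E) := NormedAlgebra.restrictScalars ℚ ℂ _
  have h : boundedGroup A t = boundedGroup B t * boundedGroup (A - B) t := by
    unfold boundedGroup
    rw [← NormedSpace.exp_add_of_commute]
    · congr 1
      rw [← smul_add, ← neg_add, ← smul_add]; simp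
    · have : Commute B (A - B) := hAB.symm.sub_right (Commute.refl B)
      exact (((this.smul_left _).smul_right _).neg_left.neg_right.smul_left _).smul_right _
  rw [h, mul_apply_eq_comp, ← map_sub, norm_boundedGroup_apply hB]
  simpa using norm_boundedGroup_sub_le (hA.sub hB) t x

/-- Second order Taylor estimate for the orbit of a bounded generator. -/
theorem norm_boundedGroup_taylor_le {A : E →L[ℂ] E} (hA : IsSelfAdjoint A) (t : ℝ) (x y v : E) :
    ‖boundedGroup A t x - x + (t : ℂ) • Complex.I • A x‖
      ≤ |t| * (2 * ‖A x - y‖ + 2 * ‖y - v‖ + |t| * ‖A v‖) := by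
  -- In the application `y = H x` and `v` is a nearby vector of the domain, so `‖A v‖` stays bounded
  -- along the approximation.
  have key : ∀ s : ℝ, |s| ≤ |t| → ‖boundedGroup A s (A x) - A x‖
      ≤ 2 * ‖A x - y‖ + 2 * ‖y - v‖ + |t| * ‖A v‖ := by
    intro s hs
    have e : boundedGroup A s (A x) - A x = boundedGroup A s (A x - y) - (A x - y)
        + (boundedGroup A s (y - v) - (y - v)) + (boundedGroup A s v - v) := by
      simp only [map_sub]; abel
    rw [e]
    refine (norm_add₃_le).trans ?_
    have h1 := norm_sub_le (boundedGroup A s (A x - y)) (A x - y)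
    have h2 := norm_sub_le (boundedGroup A s (y - v)) (y - v)
    rw [norm_boundedGroup_apply hA] at h1 h2
    have h3 := norm_boundedGroup_sub_le hA s v
    have h4 : |s| * ‖A v‖ ≤ |t| * ‖A v‖ := by gcongr
    linarith
  have hd : ∀ s : ℝ, HasDerivAt (fun s : ℝ => boundedGroup A s x + (s : ℂ) • Complex.I • A x)
      (-(Complex.I • boundedGroup A s (A x)) + (1 : ℂ) • Complex.I • A x) s := by
    intro s
    exact (hasDerivAt_boundedGroup_apply A s x).add
      ((Complex.ofRealCLM.hasDerivAt (x := s)).smul_const _)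
  have h := Convex.norm_image_sub_le_of_norm_hasDerivWithin_le (𝕜 := ℝ) (s := Set.uIcc 0 t)
    (x := 0) (y := t) (C := 2 * ‖A x - y‖ + 2 * ‖y - v‖ + |t| * ‖A v‖)
    (fun s _ => (hd s).hasDerivWithinAt)
    (fun s hs => ?_) (convex_uIcc 0 t) Set.left_mem_uIcc Set.right_mem_uIcc
  · rw [mul_comm]
    simp only [boundedGroup_zero, sub_zero, Real.norm_eq_abs] at h
    refine le_trans (le_of_eq ?_) h
    congr 1
    simp
    abel
  · have hs' : |s| ≤ |t| := by
      have := Set.abs_sub_left_of_mem_uIcc hs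
      simpa using this
    refine le_trans (le_of_eq ?_) (key s hs')
    rw [one_smul, neg_add_eq_sub, ← smul_sub, norm_smul, norm_sub_rev]
    simp

/-! ### Stone's theorem -/

/-- If commuting bounded self-adjoint operators converge strongly to `H` on its dense domain, then
their unitary groups converge strongly. -/
theorem cauchySeq_boundedGroup_apply {H : E →ₗ.[ℂ] E} (hdense : Dense (H.domain : Set E))
    {A : ℕ → E →L[ℂ] E} (hA : ∀ n, IsSelfAdjoint (A n)) (hcomm : ∀ m n, Commute (A m) (A n))
    (hconv : ∀ x : H.domain, Tendsto (fun n => A n x) atTop (𝓝 (H x))) (t : ℝ) (x : E) :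
    CauchySeq fun n => boundedGroup (A n) t x := by
  rw [Metric.cauchySeq_iff']
  intro ε hε
  obtain ⟨y, hy, hxy⟩ := Metric.dense_iff.1 hdense x (ε / 4) (by positivity)
  rw [Metric.mem_ball, dist_comm, dist_eq_norm] at hy
  have hc := (hconv ⟨y, hxy⟩).cauchySeq
  rw [Metric.cauchySeq_iff'] at hc
  obtain ⟨N, hN⟩ := hc (ε / (4 * (|t| + 1))) (by positivity)
  refine ⟨N, fun n hn => ?_⟩
  have h1 := hN n hn
  rw [dist_eq_norm] at h1 ⊢
  have e : boundedGroup (A n) t x - boundedGroup (A N) t x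
      = boundedGroup (A n) t (x - y) + (boundedGroup (A n) t y - boundedGroup (A N) t y)
        + - boundedGroup (A N) t (x - y) := by
    simp only [map_sub]; abel
  rw [e]
  have h2 := norm_boundedGroup_sub_boundedGroup_le (hA n) (hA N) (hcomm n N) t y
  have h3 : |t| * ‖A n y - A N y‖ ≤ ε / 4 := by
    have : (|t| + 1) * ‖A n y - A N y‖ ≤ (|t| + 1) * (ε / (4 * (|t| + 1))) := by
      gcongr
    have e2 : (|t| + 1) * (ε / (4 * (|t| + 1))) = ε / 4 := by field_simp
    nlinarith [norm_nonneg (A n y - A N y)]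
  have h4 := norm_add₃_le (a := boundedGroup (A n) t (x - y))
    (b := boundedGroup (A n) t y - boundedGroup (A N) t y) (c := - boundedGroup (A N) t (x - y))
  rw [norm_neg, norm_boundedGroup_apply (hA n), norm_boundedGroup_apply (hA N)] at h4
  linarith

/-- The group is the strong limit of the approximating groups. Surjectivity of `H - i` only serves
to show that the generator is no proper extension of `H`. -/
theorem exists_isUnitaryGroupOf_of_tendsto {H : E →ₗ.[ℂ] E} (hdense : Dense (H.domain : Set E))
    (hsurj : ∀ y : E, ∃ x : H.domain, H x - Complex.I • (x : E) = y)
    {A : ℕ → E →L[ℂ] E} (hA : ∀ n, IsSelfAdjoint (A n)) (hcomm : ∀ m n, Commute (A m) (A n))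
    (hconv : ∀ x : H.domain, Tendsto (fun n => A n x) atTop (𝓝 (H x))) :
    ∃ U, IsUnitaryGroupOf H U := by
  have hlim : ∀ t x, ∃ l, Tendsto (fun n => boundedGroup (A n) t x) atTop (𝓝 l) := fun t x =>
    cauchySeq_tendsto_of_complete (cauchySeq_boundedGroup_apply hdense hA hcomm hconv t x)
  choose f hf using hlim
  let U : ℝ → E →L[ℂ] E := fun t => continuousLinearMapOfTendsto (fun n => boundedGroup (A n) t)
    (tendsto_pi_nhds.2 (hf t))
  have hU : ∀ t x, Tendsto (fun n => boundedGroup (A n) t x) atTop (𝓝 (U t x)) := hf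
  have hzero : U 0 = ContinuousLinearMap.id ℂ E := by
    ext x
    refine tendsto_nhds_unique (hU 0 x) ?_
    simp [boundedGroup_zero]
  have hnorm : ∀ t x, ‖U t x‖ = ‖x‖ := by
    intro t x
    refine tendsto_nhds_unique (hU t x).norm ?_
    simp [norm_boundedGroup_apply (hA _)]
  have hadd : ∀ s t, U (s + t) = (U s).comp (U t) := by
    intro s t
    ext x
    refine tendsto_nhds_unique (hU (s + t) x) ?_
    have h1 : Tendsto (fun n => boundedGroup (A n) s (boundedGroup (A n) t x - U t x)) atTop
        (𝓝 0) := by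
      rw [tendsto_zero_iff_norm_tendsto_zero]
      simp only [norm_boundedGroup_apply (hA _)]
      have := (hU t x).sub_const (U t x)
      rw [sub_self] at this
      simpa using this.norm
    have h2 := h1.add (hU s (U t x))
    simpa [boundedGroup_add] using h2
  have hlip : ∀ (t : ℝ) (x : H.domain), ‖U t x - x‖ ≤ |t| * ‖H x‖ := fun t x =>
    le_of_tendsto_of_tendsto ((hU t x).sub_const _).norm ((hconv x).norm.const_mul |t|)
      (Eventually.of_forall fun n => norm_boundedGroup_sub_le (hA n) t x)
  have hcont0 : ∀ x : E, Tendsto (fun t => U t x) (𝓝 0) (𝓝 x) := by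
    intro x
    rw [Metric.tendsto_nhds]
    intro ε hε
    obtain ⟨y, hy, hxy⟩ := Metric.dense_iff.1 hdense x (ε / 4) (by positivity)
    rw [Metric.mem_ball, dist_comm, dist_eq_norm] at hy
    have hc : Tendsto (fun t : ℝ => |t| * ‖H ⟨y, hxy⟩‖) (𝓝 0) (𝓝 0) := by
      have : Continuous fun t : ℝ => |t| * ‖H ⟨y, hxy⟩‖ := by fun_prop
      simpa using this.tendsto 0
    filter_upwards [hc.eventually_lt_const (show 0 < ε / 4 by positivity)] with t ht
    have e : U t x - x = U t (x - y) + (U t y - y) + -(x - y) := by simp only [map_sub]; abel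
    have h4 := norm_add₃_le (a := U t (x - y)) (b := U t y - y) (c := -(x - y))
    have h5 := hlip t ⟨y, hxy⟩
    rw [norm_neg, hnorm] at h4
    rw [dist_eq_norm, e]
    simp only at h5
    linarith
  have hcont : ∀ x : E, Continuous fun t => U t x := by
    intro x
    rw [continuous_iff_continuousAt]
    intro s
    have h1 : Tendsto (fun t => U s (U (t - s) x)) (𝓝 s) (𝓝 (U s x)) := by
      refine ((U s).continuous.tendsto x).comp ((hcont0 x).comp ?_)
      have : Continuous fun t : ℝ => t - s := by fun_prop
      simpa using this.tendsto s
    refine h1.congr fun t => ?_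
    rw [← ContinuousLinearMap.comp_apply, ← hadd]
    simp
  have hgen : ∀ x : H.domain, HasDerivAt (fun t : ℝ => U t x) (-(Complex.I • H x)) 0 := by
    intro x
    have hbound : ∀ (t : ℝ) (v : H.domain), ‖U t x - x + (t : ℂ) • Complex.I • H x‖
        ≤ |t| * (2 * ‖H x - v‖ + |t| * ‖H v‖) := by
      intro t v
      have hl : Tendsto (fun n => |t| * (2 * ‖A n x - H x‖ + 2 * ‖H x - v‖ + |t| * ‖A n v‖)) atTop
          (𝓝 (|t| * (2 * ‖H x - H x‖ + 2 * ‖H x - v‖ + |t| * ‖H v‖))) :=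
        (((((hconv x).sub_const _).norm.const_mul 2).add_const _).add
          ((hconv v).norm.const_mul _)).const_mul _
      have := le_of_tendsto_of_tendsto
        ((((hU t x).sub_const (x : E)).add
          (((hconv x).const_smul Complex.I).const_smul (t : ℂ))).norm) hl
        (Eventually.of_forall fun n => norm_boundedGroup_taylor_le (hA n) t x (H x) v)
      simpa using this
    rw [hasDerivAt_iff_isLittleO_nhds_zero, Asymptotics.isLittleO_iff]
    intro ε hε
    obtain ⟨y, hy, hxy⟩ := Metric.dense_iff.1 hdense (H x) (ε / 4) (by positivity)
    rw [Metric.mem_ball, dist_comm, dist_eq_norm] at hy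
    have hc : Tendsto (fun t : ℝ => |t| * ‖H ⟨y, hxy⟩‖) (𝓝 0) (𝓝 0) := by
      have : Continuous fun t : ℝ => |t| * ‖H ⟨y, hxy⟩‖ := by fun_prop
      simpa using this.tendsto 0
    filter_upwards [hc.eventually_lt_const (show 0 < ε / 4 by positivity)] with t ht
    have h5 := hbound t ⟨y, hxy⟩
    have e : U (0 + t) x - U 0 x - t • -(Complex.I • H x)
        = U t x - x + (t : ℂ) • Complex.I • H x := by
      simp [hzero]
    rw [e, Real.norm_eq_abs, mul_comm]
    refine h5.trans ?_
    gcongr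
    simp only
    linarith
  refine ⟨U, hzero, hadd, hnorm, hcont, fun x y => ⟨?_, fun hxy => ?_⟩⟩
  · rintro ⟨hx, rfl⟩
    exact hgen ⟨x, hx⟩
  -- With this choice `w = x - x'` satisfies `(U t w)' = w` at 0. As `‖U t w‖` is constant, the
  -- derivative `2‖w‖²` of its square vanishes, so `x = x'` lies in the domain.
  · obtain ⟨x', hx'⟩ := hsurj (y - Complex.I • x)
    have hw : HasDerivAt (fun t : ℝ => U t (x - x')) (x - x') 0 := by
      have h := hxy.sub (hgen x')
      have e : -(Complex.I • y) - -(Complex.I • H x') = x - x' := by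
        have : H x' = y - Complex.I • x + Complex.I • (x' : E) := by rw [← hx']; abel
        rw [this, neg_sub_neg, ← smul_sub]
        simp only [add_sub_assoc]
        rw [show y - Complex.I • x + (Complex.I • (x' : E) - y) = Complex.I • ((x' : E) - x) by
          rw [smul_sub]; abel, smul_smul, Complex.I_mul_I, neg_one_smul, neg_sub]
      rw [e] at h
      refine h.congr_of_eventuallyEq (Eventually.of_forall fun t => ?_)
      simp
    have hsq := hw.inner ℂ hw
    have hconst : HasDerivAt (fun t : ℝ => inner ℂ (U t (x - x')) (U t (x - x'))) 0 0 := by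
      simp only [inner_self_eq_norm_sq_to_K, hnorm]
      exact hasDerivAt_const _ _
    have h0 := hsq.unique hconst
    simp only [hzero, ContinuousLinearMap.id_apply] at h0
    have h1 : x - x' = 0 := by
      rw [← two_mul] at h0
      exact inner_self_eq_zero.1 ((mul_eq_zero.1 h0).resolve_left two_ne_zero)
    have h3 : x = x' := sub_eq_zero.1 h1
    refine ⟨h3 ▸ x'.2, ?_⟩
    have h4 : (⟨x, h3 ▸ x'.2⟩ : H.domain) = x' := Subtype.ext h3
    rw [h4]
    rw [← h3] at hx'
    simpa using hx'

end Stone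

/-! ### Resolvents of symmetric operators and Yosida approximation. -/

section Yosida

variable {E : Type*} [NormedAddCommGroup E] [InnerProductSpace ℂ E]

/-- `H` is symmetric on its domain. -/
def IsSymmetricOn (H : E →ₗ.[ℂ] E) : Prop :=
  ∀ x y : H.domain, inner ℂ (H x) (y : E) = inner ℂ (x : E) (H y)

/-- The cross term vanishes because `⟨H x, x⟩` is real. -/
theorem IsSymmetricOn.norm_sq_sub_smul {H : E →ₗ.[ℂ] E} (hs : IsSymmetricOn H) (s : ℝ)
    (x : H.domain) :
    ‖H x - (Complex.I * s) • (x : E)‖ ^ 2 = ‖H x‖ ^ 2 + s ^ 2 * ‖(x : E)‖ ^ 2 := by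
  have h0 : (inner ℂ (H x) (x : E)).im = 0 := by
    have h1 := inner_conj_symm (𝕜 := ℂ) (x : E) (H x)
    rw [← hs x x] at h1
    exact Complex.conj_eq_iff_im.1 h1
  rw [norm_sub_sq (𝕜 := ℂ), inner_smul_right, norm_smul]
  simp [h0, mul_pow]

theorem IsSymmetricOn.norm_le {H : E →ₗ.[ℂ] E} (hs : IsSymmetricOn H) {s : ℝ} (h0 : s ≠ 0)
    (x : H.domain) : ‖(x : E)‖ ≤ |s|⁻¹ * ‖H x - (Complex.I * s) • (x : E)‖ := by
  have h := hs.norm_sq_sub_smul s x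
  have h1 : |s| * ‖(x : E)‖ ≤ ‖H x - (Complex.I * s) • (x : E)‖ := by
    apply (pow_le_pow_iff_left₀ (by positivity) (norm_nonneg _) two_ne_zero).1
    rw [mul_pow, sq_abs, h]
    nlinarith [sq_nonneg ‖H x‖]
  have : 0 < |s| := abs_pos.2 h0
  rw [inv_mul_eq_div, le_div_iff₀ this, mul_comm]
  exact h1

/-- The resolvent at `i s`. -/
theorem IsSymmetricOn.exists_resolvent {H : E →ₗ.[ℂ] E} (hs : IsSymmetricOn H) {s : ℝ} (h0 : s ≠ 0)
    (hsurj : ∀ y : E, ∃ x : H.domain, H x - (Complex.I * s) • (x : E) = y) :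
    ∃ R : E →L[ℂ] E, (∀ y, ‖R y‖ ≤ |s|⁻¹ * ‖y‖) ∧
      ∀ x y : E, R y = x ↔ ∃ hx : x ∈ H.domain, H ⟨x, hx⟩ - (Complex.I * s) • x = y := by
  have huniq : ∀ x x' : H.domain, H x - (Complex.I * s) • (x : E) =
      H x' - (Complex.I * s) • (x' : E) → x = x' := by
    intro x x' h
    have h1 := hs.norm_le h0 (x - x')
    rw [LinearPMap.map_sub, H.domain.coe_sub, smul_sub, sub_sub_sub_comm, h, sub_self, norm_zero,
      mul_zero, norm_le_zero_iff] at h1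
    exact Subtype.ext (sub_eq_zero.1 h1)
  choose f hf using hsurj
  let L : E →ₗ[ℂ] E :=
    { toFun := fun y => f y
      map_add' := by
        intro y y'
        rw [← H.domain.coe_add]
        congr 1
        apply huniq
        rw [hf, LinearPMap.map_add, H.domain.coe_add, smul_add, add_sub_add_comm, hf, hf]
      map_smul' := by
        intro c y
        rw [RingHom.id_apply, ← H.domain.coe_smul]
        congr 1
        apply huniq
        rw [hf, LinearPMap.map_smul, H.domain.coe_smul, smul_comm, ← smul_sub, hf] }
  have hb : ∀ y, ‖L y‖ ≤ |s|⁻¹ * ‖y‖ := by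
    intro y
    have := hs.norm_le h0 (f y)
    rwa [hf] at this
  refine ⟨L.mkContinuous _ hb, hb, fun x y => ⟨?_, ?_⟩⟩
  · rintro rfl
    exact ⟨(f y).2, hf y⟩
  · rintro ⟨hx, h⟩
    have := huniq (f y) ⟨x, hx⟩ (by rw [hf, h])
    exact congrArg Subtype.val this

/-- The resolvents at `i s`, `s ≠ 0`, with the adjoint relation and the resolvent identity. -/
theorem IsSymmetricOn.exists_resolvent_family {H : E →ₗ.[ℂ] E} (hs : IsSymmetricOn H)
    (hsurj : ∀ s : ℝ, s ≠ 0 → ∀ y : E, ∃ x : H.domain, H x - (Complex.I * s) • (x : E) = y) :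
    ∃ R : {s : ℝ // s ≠ 0} → E →L[ℂ] E,
      (∀ s y, ‖R s y‖ ≤ |(s : ℝ)|⁻¹ * ‖y‖) ∧
      (∀ s y, ∃ h : R s y ∈ H.domain, H ⟨R s y, h⟩ = y + (Complex.I * (s : ℝ)) • R s y) ∧
      (∀ s (x : H.domain), R s (H x) = x + (Complex.I * (s : ℝ)) • R s x) ∧
      (∀ s t : {s : ℝ // s ≠ 0}, (t : ℝ) = -s → ∀ x y, inner ℂ (R s x) y = inner ℂ x (R t y)) ∧
      ∀ s t : {s : ℝ // s ≠ 0}, R s - R t = (Complex.I * ((s : ℝ) - (t : ℝ))) • (R s * R t) := by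
  have hres : ∀ s : {s : ℝ // s ≠ 0}, ∃ R : E →L[ℂ] E, (∀ y, ‖R y‖ ≤ |(s : ℝ)|⁻¹ * ‖y‖) ∧
      ∀ x y : E, R y = x ↔ ∃ hx : x ∈ H.domain, H ⟨x, hx⟩ - (Complex.I * (s : ℝ)) • x = y :=
    fun s => hs.exists_resolvent s.2 (hsurj s s.2)
  choose R hR hRiff using hres
  have hmem : ∀ s y, R s y ∈ H.domain := fun s y => ((hRiff s _ y).1 rfl).1
  have hH : ∀ s y, H ⟨R s y, hmem s y⟩ = y + (Complex.I * (s : ℝ)) • R s y := by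
    intro s y
    rw [← sub_eq_iff_eq_add]
    exact ((hRiff s _ y).1 rfl).2
  have hRH : ∀ s (x : H.domain), R s (H x) = x + (Complex.I * (s : ℝ)) • R s x := by
    intro s x
    have h1 : R s (H x - (Complex.I * (s : ℝ)) • (x : E)) = x := (hRiff s _ _).2 ⟨x.2, rfl⟩
    rw [map_sub, map_smul, sub_eq_iff_eq_add] at h1
    exact h1
  refine ⟨R, hR, fun s y => ⟨hmem s y, hH s y⟩, hRH, fun s t hst x y => ?_, fun s t => ?_⟩
  · have h := hs ⟨R s x, hmem s x⟩ ⟨R t y, hmem _ y⟩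
    rw [hH, hH] at h
    simp only [inner_add_left, inner_add_right, inner_smul_left, inner_smul_right] at h
    simp [hst] at h
    exact h.symm
  · ext y
    have h := hRH s ⟨R t y, hmem t y⟩
    rw [hH, map_add, map_smul] at h
    simp only at h
    rw [sub_apply, smul_apply, mul_apply_eq_comp, mul_sub, sub_smul, sub_eq_sub_iff_add_eq_add, h]
    abel

variable [CompleteSpace E]

/-- Stone's theorem: a densely defined symmetric operator `H` such that `H - i s` is onto for all
real `s ≠ 0` generates a unitary group. -/
theorem exists_isUnitaryGroupOf {H : E →ₗ.[ℂ] E} (hdense : Dense (H.domain : Set E))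
    (hs : IsSymmetricOn H)
    (hsurj : ∀ s : ℝ, s ≠ 0 → ∀ y : E, ∃ x : H.domain, H x - (Complex.I * s) • (x : E) = y) :
    ∃ U, IsUnitaryGroupOf H U := by
  obtain ⟨R, hR, -, hRH, hadj', hresolvent⟩ := hs.exists_resolvent_family hsurj
  let neg : {s : ℝ // s ≠ 0} → {s : ℝ // s ≠ 0} := fun s => ⟨-s, neg_ne_zero.2 s.2⟩
  have hadj : ∀ s x y, inner ℂ (R s x) y = inner ℂ x (R (neg s) y) := fun s => hadj' s _ rfl
  have hRcomm : ∀ s t, Commute (R s) (R t) := by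
    intro s t
    by_cases hst : s = t
    · rw [hst]
    · have hne : Complex.I * (((s : ℝ) : ℂ) - ((t : ℝ) : ℂ)) ≠ 0 := by
        refine mul_ne_zero Complex.I_ne_zero (sub_ne_zero.2 fun h => hst ?_)
        exact Subtype.ext (Complex.ofReal_injective h)
      have h1 := hresolvent s t
      have h2 := hresolvent t s
      rw [← neg_sub, h1, ← neg_sub ((s : ℝ) : ℂ), mul_neg, neg_smul, neg_inj] at h2
      exact smul_right_injective _ hne h2
  let σ : ℕ → {s : ℝ // s ≠ 0} := fun n => ⟨n + 1, by positivity⟩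
  -- Formally `s²H/(H² + s²)` with `s = n + 1`; combining the resolvents at `is` and `-is` makes it
  -- self-adjoint.
  let A : ℕ → E →L[ℂ] E := fun n =>
    ((((n : ℝ) + 1) ^ 2 / 2 : ℝ) : ℂ) • (R (σ n) + R (neg (σ n)))
  have hA : ∀ n, IsSelfAdjoint (A n) := by
    intro n
    rw [ContinuousLinearMap.isSelfAdjoint_iff_isSymmetric]
    intro x y
    have hnn : neg (neg (σ n)) = σ n := Subtype.ext (neg_neg _)
    simp only [A, ContinuousLinearMap.coe_coe, smul_apply,
      add_apply, inner_smul_left, inner_smul_right, inner_add_left,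
      inner_add_right, hadj, hnn, Complex.conj_ofReal]
    ring
  have hcomm : ∀ m n, Commute (A m) (A n) := by
    intro m n
    refine Commute.smul_left (Commute.smul_right ?_ _) _
    exact ((hRcomm _ _).add_right (hRcomm _ _)).add_left ((hRcomm _ _).add_right (hRcomm _ _))
  -- Formally `s²/(H² + s²)`: a contraction with `A n = J n H` on the domain, tending strongly to
  -- the identity.
  let J : ℕ → E →L[ℂ] E := fun n =>
    (-(Complex.I * (((n : ℝ) + 1) / 2 : ℝ))) • (R (σ n) - R (neg (σ n)))
  have habs : ∀ n : ℕ, |(n : ℝ) + 1| = n + 1 := fun n => abs_of_pos (by positivity)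
  have hσ : ∀ n y, ‖R (σ n) y‖ ≤ ((n : ℝ) + 1)⁻¹ * ‖y‖ := by
    intro n y
    have := hR (σ n) y
    simpa [σ, habs] using this
  have hσ' : ∀ n y, ‖R (neg (σ n)) y‖ ≤ ((n : ℝ) + 1)⁻¹ * ‖y‖ := by
    intro n y
    have := hR (neg (σ n)) y
    simp only [neg, σ, abs_neg, habs] at this
    exact this
  have hAJ : ∀ n (x : H.domain), A n x = J n (H x) := by
    intro n x
    simp only [A, J, smul_apply, add_apply,
      sub_apply, hRH]
    rw [add_sub_add_left_eq_sub]
    simp only [neg, σ, smul_sub, smul_add, smul_smul]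
    rw [sub_eq_add_neg, ← neg_smul]
    congr 2
    · push_cast; linear_combination ((n : ℂ) + 1) ^ 2 / 2 * Complex.I_sq
    · push_cast; linear_combination ((n : ℂ) + 1) ^ 2 / 2 * Complex.I_sq
  have hJnorm : ∀ n y, ‖J n y‖ ≤ ‖y‖ := by
    intro n y
    simp only [J, smul_apply, sub_apply]
    have hp : (0 : ℝ) < n + 1 := by positivity
    rw [norm_smul, norm_neg, norm_mul, Complex.norm_I, one_mul, Complex.norm_real,
      Real.norm_of_nonneg (by positivity)]
    have h1 := norm_sub_le (R (σ n) y) (R (neg (σ n)) y)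
    have h2 : ‖R (σ n) y - R (neg (σ n)) y‖ ≤ 2 * (((n : ℝ) + 1)⁻¹ * ‖y‖) := by
      linarith [hσ n y, hσ' n y]
    calc ((n : ℝ) + 1) / 2 * ‖R (σ n) y - R (neg (σ n)) y‖
        ≤ ((n : ℝ) + 1) / 2 * (2 * (((n : ℝ) + 1)⁻¹ * ‖y‖)) := by gcongr
      _ = ‖y‖ := by field_simp
  have hJdom : ∀ n (x : H.domain), ‖J n x - x‖ ≤ ((n : ℝ) + 1)⁻¹ * ‖H x‖ := by
    intro n x
    have hp : (0 : ℝ) < n + 1 := by positivity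
    have e : J n x - x = (-(1 / 2 : ℂ)) • (R (σ n) (H x) + R (neg (σ n)) (H x)) := by
      simp only [J, smul_apply, sub_apply, hRH]
      simp only [neg, σ, smul_sub, smul_add, smul_smul]
      push_cast
      module
    rw [e, norm_smul]
    have h1 := norm_add_le (R (σ n) (H x)) (R (neg (σ n)) (H x))
    have h2 : ‖(-(1 / 2 : ℂ))‖ = 1 / 2 := by simp
    rw [h2]
    linarith [hσ n (H x), hσ' n (H x)]
  have hJlim : ∀ y, Tendsto (fun n => J n y) atTop (𝓝 y) := by
    intro y
    rw [Metric.tendsto_nhds]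
    intro ε hε
    obtain ⟨v, hv, hvd⟩ := Metric.dense_iff.1 hdense y (ε / 4) (by positivity)
    rw [Metric.mem_ball, dist_comm, dist_eq_norm] at hv
    have hc : Tendsto (fun n : ℕ => ((n : ℝ) + 1)⁻¹ * ‖H ⟨v, hvd⟩‖) atTop (𝓝 0) := by
      have h1 : Tendsto (fun n : ℕ => ((n : ℝ) + 1)⁻¹) atTop (𝓝 0) := by
        simpa using tendsto_one_div_add_atTop_nhds_zero_nat (𝕜 := ℝ)
      simpa using h1.mul_const ‖H ⟨v, hvd⟩‖
    filter_upwards [hc.eventually_lt_const (show 0 < ε / 4 by positivity)] with n hn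
    have e : J n y - y = J n (y - v) + (J n v - v) + -(y - v) := by simp only [map_sub]; abel
    have h4 := norm_add₃_le (a := J n (y - v)) (b := J n v - v) (c := -(y - v))
    have h5 := hJdom n ⟨v, hvd⟩
    have h6 := hJnorm n (y - v)
    rw [norm_neg] at h4
    rw [dist_eq_norm, e]
    simp only at h5
    linarith
  refine exists_isUnitaryGroupOf_of_tendsto hdense ?_ hA hcomm fun x => ?_
  · intro y
    simpa using hsurj 1 one_ne_zero y
  · simp only [hAJ]
    exact hJlim (H x)

end Yosida

/-! ### Existence of spectral measures -/

section Spectral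

open MeasureTheory
open scoped CompactlySupported

variable {E : Type*} [NormedAddCommGroup E] [InnerProductSpace ℂ E] [CompleteSpace E]

/-- A real continuous function, as a complex one. -/
def complexify {X : Type*} [TopologicalSpace X] (f : C(X, ℝ)) : C(X, ℂ) :=
  ⟨fun x => (f x : ℂ), by fun_prop⟩

/-- Riesz–Markov for `f ↦ ⟨ψ, f(R)ψ⟩`, which is positive because `f = g²` with `g = √f` gives
`‖g(R)ψ‖²`. -/
theorem exists_measure_inner_cfcHom {R : E →L[ℂ] E} (hR : IsStarNormal R) (ψ : E) :
    ∃ ν : Measure (spectrum ℂ R), IsFiniteMeasure ν ∧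
      ∀ f : C(spectrum ℂ R, ℂ), inner ℂ ψ (cfcHom hR f ψ) = ∫ x, f x ∂ν := by
  set X := spectrum ℂ R
  have hsa : ∀ f : C(X, ℝ), (inner ℂ ψ (cfcHom hR (complexify f) ψ)).im = 0 := by
    intro f
    have h1 : IsSelfAdjoint (cfcHom hR (complexify f)) := by
      have h2 : IsSelfAdjoint (complexify f) := by
        ext x
        simp [complexify]
      exact h2.map (cfcHom hR)
    have h3 := inner_conj_symm (𝕜 := ℂ) ψ (cfcHom hR (complexify f) ψ)
    have h4 : inner ℂ (cfcHom hR (complexify f) ψ) ψ = inner ℂ ψ (cfcHom hR (complexify f) ψ) :=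
      (ContinuousLinearMap.isSelfAdjoint_iff_isSymmetric.1 h1) ψ ψ
    rw [h4] at h3
    exact Complex.conj_eq_iff_im.1 h3
  let ℓ : C_c(X, ℝ) →ₗ[ℝ] ℝ :=
    { toFun := fun f => (inner ℂ ψ (cfcHom hR (complexify f.toContinuousMap) ψ)).re
      map_add' := by
        intro f g
        have : complexify (f + g).toContinuousMap
            = complexify f.toContinuousMap + complexify g.toContinuousMap := by
          ext x
          simp [complexify]
        rw [this, map_add, add_apply, inner_add_right, Complex.add_re]
      map_smul' := by
        intro c f
        have : complexify (c • f).toContinuousMap = (c : ℂ) • complexify f.toContinuousMap := by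
          ext x
          simp [complexify]
        rw [this, map_smul, smul_apply, inner_smul_right, Complex.re_ofReal_mul]
        rfl }
  have hpos : ∀ f : C_c(X, ℝ), 0 ≤ f → 0 ≤ ℓ f := by
    intro f hf
    let g : C(X, ℝ) := ⟨fun x => Real.sqrt (f x), by fun_prop⟩
    have hg : complexify f.toContinuousMap = star (complexify g) * complexify g := by
      ext x
      have : 0 ≤ f x := hf x
      simp [complexify, g, ← Complex.ofReal_mul, Real.mul_self_sqrt this]
    change 0 ≤ (inner ℂ ψ (cfcHom hR (complexify f.toContinuousMap) ψ)).re
    rw [hg, map_mul, map_star, mul_apply_eq_comp, ContinuousLinearMap.star_eq_adjoint,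
      ContinuousLinearMap.adjoint_inner_right]
    exact inner_self_nonneg (𝕜 := ℂ)
  let Λ : C_c(X, ℝ) →ₚ[ℝ] ℝ := PositiveLinearMap.mk₀ ℓ hpos
  have hreal : ∀ f : C(X, ℝ), inner ℂ ψ (cfcHom hR (complexify f) ψ)
      = ((∫ x, f x ∂(RealRMK.rieszMeasure Λ) : ℝ) : ℂ) := by
    intro f
    have h := RealRMK.integral_rieszMeasure Λ
      (CompactlySupportedContinuousMap.continuousMapEquiv f)
    have h2 : Λ (CompactlySupportedContinuousMap.continuousMapEquiv f)
        = (inner ℂ ψ (cfcHom hR (complexify f) ψ)).re := rfl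
    rw [h2] at h
    apply Complex.ext
    · rw [Complex.ofReal_re, ← h]
      rfl
    · rw [hsa, Complex.ofReal_im]
  refine ⟨RealRMK.rieszMeasure Λ, inferInstance, fun f => ?_⟩
  let u : C(X, ℝ) := ⟨fun x => (f x).re, by fun_prop⟩
  let v : C(X, ℝ) := ⟨fun x => (f x).im, by fun_prop⟩
  have huv : f = complexify u + Complex.I • complexify v := by
    ext x
    simp [complexify, u, v, mul_comm Complex.I, Complex.re_add_im]
  have hint : Integrable f (RealRMK.rieszMeasure Λ) :=
    f.continuous.integrable_of_hasCompactSupport (HasCompactSupport.of_compactSpace f)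
  rw [show inner ℂ ψ (cfcHom hR f ψ) = inner ℂ ψ (cfcHom hR (complexify u) ψ)
      + Complex.I * inner ℂ ψ (cfcHom hR (complexify v) ψ) by
    conv_lhs => rw [huv]
    rw [map_add, map_smul, add_apply, smul_apply, inner_add_right, inner_smul_right]]
  rw [hreal, hreal]
  have := integral_re_add_im hint
  rw [← this, mul_comm]
  rfl

/-- A symmetric operator `H` such that `H - i s` is onto for all real `s ≠ 0` has spectral
measures. -/
theorem exists_isSpectralMeasure {H : E →ₗ.[ℂ] E} (hs : IsSymmetricOn H)
    (hsurj : ∀ s : ℝ, s ≠ 0 → ∀ y : E, ∃ x : H.domain, H x - (Complex.I * s) • (x : E) = y)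
    (ψ : E) : ∃ μ, IsSpectralMeasure H ψ μ := by
  obtain ⟨F, -, hdom, -, hadj, hres⟩ := hs.exists_resolvent_family hsurj
  -- `R = (H - i)⁻¹` is normal; the measure of `H` is that of `R` transported by `r ↦ 1/r + i`.
  set R := F ⟨1, one_ne_zero⟩
  have hstar : star R = F ⟨-1, by norm_num⟩ := by
    rw [ContinuousLinearMap.star_eq_adjoint]
    symm
    rw [ContinuousLinearMap.eq_adjoint_iff]
    intro x y
    exact hadj _ _ (by norm_num) x y
  have h1 : R - star R = (2 * Complex.I) • (R * star R) := by
    rw [hstar, hres]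
    congr 1
    push_cast
    ring
  have hR : IsStarNormal R := by
    refine ⟨?_⟩
    have h2I : (-(2 * Complex.I)) ≠ 0 := by simp
    have h3 : star R - R = (-(2 * Complex.I)) • (star R * R) := by
      rw [hstar, hres]
      congr 1
      push_cast
      ring
    rw [← neg_sub, h1, ← neg_smul] at h3
    exact (smul_right_injective _ h2I h3).symm
  obtain ⟨ν, hν, hint⟩ := exists_measure_inner_cfcHom hR ψ
  let ι : C(spectrum ℂ R, ℂ) := (ContinuousMap.id ℂ).restrict (spectrum ℂ R)
  have hι : cfcHom hR ι = R := cfcHom_id hR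
  -- The spectrum of `R` lies on the circle `Im r = |r|²`, the image of the real line with `∞` under
  -- `x ↦ 1/(x - i)`.
  have hspec : ∀ r : spectrum ℂ R, (r : ℂ) - star (r : ℂ) = 2 * Complex.I * (r * star (r : ℂ)) := by
    have h4 : ι - star ι = (2 * Complex.I) • (ι * star ι) := by
      apply cfcHom_injective hR
      rw [map_sub, map_smul, map_mul, map_star, hι, h1]
    intro r
    exact congrArg (fun f : C(spectrum ℂ R, ℂ) => f r) h4
  let ξ : spectrum ℂ R → ℝ := fun r => ((r : ℂ)⁻¹).re
  have hξ : ∀ r : spectrum ℂ R, (r : ℂ) ≠ 0 → (r : ℂ)⁻¹ + Complex.I = ξ r := by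
    intro r hr
    have hr' : star (r : ℂ) ≠ 0 := star_ne_zero.2 hr
    have h5 : star (r : ℂ)⁻¹ = (r : ℂ)⁻¹ + 2 * Complex.I := by
      have := hspec r
      rw [star_inv₀]
      field_simp
      linear_combination this
    have h6 := congrArg Complex.im h5
    simp [neg_div] at h6
    apply Complex.ext
    · simp [ξ]
    · simp [neg_div]
      linarith
  have hξm : Measurable ξ := by
    have : Measurable fun r : spectrum ℂ R => ((r : ℂ)⁻¹).re := by fun_prop
    exact this
  -- The point `r = 0` corresponds to `x = ∞`, where `ξ` takes the default value 0. Dropping it is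
  -- harmless, since the integrand `r/(1 + (i - z)r)` vanishes there.
  let X₀ : Set (spectrum ℂ R) := {r | (r : ℂ) ≠ 0}
  have hX₀ : MeasurableSet X₀ := by
    have : Measurable fun r : spectrum ℂ R => (r : ℂ) := measurable_subtype_coe
    exact (this (measurableSet_singleton 0)).compl
  refine ⟨(ν.restrict X₀).map ξ, inferInstance, fun z hz => ?_⟩
  have hden : ∀ r : spectrum ℂ R, 1 + (Complex.I - z) * r ≠ 0 := by
    intro r h
    have hr : (r : ℂ) ≠ 0 := by
      intro h0
      simp [h0] at h
    have h7 : (ξ r : ℂ) = z := by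
      rw [← hξ r hr]
      field_simp
      linear_combination h
    exact hz (by rw [← h7]; simp)
  -- From `(H - z)⁻¹ = R (1 + (i - z)R)⁻¹`.
  let q : C(spectrum ℂ R, ℂ) := ⟨fun r => (1 + (Complex.I - z) * r)⁻¹, Continuous.inv₀ (by fun_prop) hden⟩
  have hq : (1 + (Complex.I - z) • ι) * q = 1 := by
    ext r
    exact mul_inv_cancel₀ (hden r)
  have hqR : ∀ y, cfcHom hR q y + (Complex.I - z) • R (cfcHom hR q y) = y := by
    intro y
    have h8 := congrArg (cfcHom hR) hq
    rw [map_mul, map_add, map_one, map_smul, hι] at h8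
    have h9 := congrArg (fun A : E →L[ℂ] E => A y) h8
    simpa using h9
  obtain ⟨hmem, hH⟩ := hdom ⟨1, one_ne_zero⟩ (cfcHom hR q ψ)
  refine ⟨⟨R (cfcHom hR q ψ), hmem⟩, ?_, ?_⟩
  · rw [hH]
    have := hqR ψ
    rw [sub_smul] at this
    simp only [Complex.ofReal_one, mul_one]
    rw [add_sub_assoc]
    exact this
  · have h10 : R (cfcHom hR q ψ) = cfcHom hR (ι * q) ψ := by
      rw [map_mul, hι]
      rfl
    simp only
    rw [h10, hint]
    have hmeas : Measurable fun x : ℝ => ((x : ℂ) - z)⁻¹ := by fun_prop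
    rw [integral_map hξm.aemeasurable hmeas.aestronglyMeasurable, ← integral_indicator hX₀]
    refine integral_congr_ae (Eventually.of_forall fun r => ?_)
    by_cases hr : (r : ℂ) = 0
    · rw [Set.indicator_of_notMem (show r ∉ X₀ from fun h => h hr)]
      change (r : ℂ) * _ = 0
      rw [hr, zero_mul]
    · rw [Set.indicator_of_mem (show r ∈ X₀ from hr), ← hξ r hr]
      change (r : ℂ) * (1 + (Complex.I - z) * r)⁻¹ = _
      have h11 := hden r
      have h12 : (r : ℂ)⁻¹ + Complex.I - z = (1 + (Complex.I - z) * r) / r := by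
        field_simp
        ring
      rw [h12, inv_div]
      rfl

end Spectral

section

/-! ### Self-adjointness of the half-line operator -/

/-- The vector concentrated at the site `k + 1`. -/
def delta (k : ℕ) : HalfLine := lp.single 2 k 1

theorem delta_zero : delta 0 = delta1 := rfl

theorem delta_apply (k j : ℕ) : delta k j = if j = k then 1 else 0 := by
  simp [delta, Pi.single_apply]

theorem halfLine_add_apply (u v : HalfLine) (k : ℕ) : (u + v) k = u k + v k := rfl

theorem halfLine_smul_apply (c : ℂ) (u : HalfLine) (k : ℕ) : (c • u) k = c * u k := rfl

theorem inner_delta (k : ℕ) (w : HalfLine) : inner ℂ (delta k) w = w k := by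
  rw [delta, lp.inner_single_left]
  simp

theorem summable_norm_sq (u : HalfLine) : Summable fun k => ‖u k‖ ^ 2 := by
  have := (lp.memℓp u).summable (by norm_num)
  simpa using this

theorem summable_norm_sq_site (u : HalfLine) : Summable fun n => ‖site u n‖ ^ 2 :=
  (summable_nat_add_iff 1).1 (summable_norm_sq u)

variable (a b : ℕ → ℝ)

theorem jacobiExpr_delta (k : ℕ) : jacobiExpr a b (delta k) =
    ((a (k + 1) : ℂ) • delta (k + 1) + (b (k + 1) : ℂ) • delta k
      + match k with
        | 0 => 0
        | j + 1 => (a (j + 1) : ℂ) • delta j : HalfLine) := by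
  funext j
  rcases k with _ | k
  · rcases j with _ | _ | j <;>
      simp [jacobiExpr, site, halfLine_add_apply, halfLine_smul_apply, delta_apply,
        -Complex.coe_smul, -lp.coeFn_add, -lp.coeFn_smul]
  · rcases j with _ | j <;>
      simp only [jacobiExpr, site, halfLine_add_apply, halfLine_smul_apply, delta_apply] <;>
      split_ifs <;> first | omega | simp_all

theorem delta_mem_domain (k : ℕ) : delta k ∈ (halfLineOp a b).domain := by
  change Memℓp (jacobiExpr a b (delta k)) 2
  rw [jacobiExpr_delta]
  exact lp.memℓp _

theorem halfLineOp_apply (u : (halfLineOp a b).domain) (k : ℕ) :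
    halfLineOp a b u k = jacobiExpr a b (u : HalfLine) k := rfl

/-- Here `w` need not lie in the domain. This expresses each coordinate of the difference expression
as a bounded functional on `ℓ²`. -/
theorem inner_halfLineOp_delta (k : ℕ) (w : HalfLine) :
    inner ℂ (halfLineOp a b ⟨delta k, delta_mem_domain a b k⟩) w = jacobiExpr a b w k := by
  have h : halfLineOp a b ⟨delta k, delta_mem_domain a b k⟩ = _ :=
    lp.ext (jacobiExpr_delta a b k)
  rw [h, inner_add_left, inner_add_left, inner_smul_left, inner_smul_left, inner_delta,
    inner_delta]
  cases k with
  | zero => simp [jacobiExpr, site]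
  | succ k => simp [jacobiExpr, site, inner_smul_left, inner_delta, -Complex.coe_smul]; ring

theorem dense_domain : Dense ((halfLineOp a b).domain : Set HalfLine) := by
  rw [Submodule.dense_iff_topologicalClosure_eq_top, Submodule.topologicalClosure_eq_top_iff,
    Submodule.eq_bot_iff]
  intro w hw
  ext k
  rw [← inner_delta]
  exact (Submodule.mem_orthogonal _ _).1 hw _ (delta_mem_domain a b k)

/-- The Wronskian of two sequences at the bond between the sites `n` and `n + 1`. -/
def wronskian (u v : ℕ → ℂ) (n : ℕ) : ℂ := a n * (u (n + 1) * v n - u n * v (n + 1))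

/-- Discrete Green formula; the Dirichlet condition removes the boundary term at 0. -/
theorem sum_jacobiExpr_mul_sub (u v : ℕ → ℂ) (n : ℕ) :
    ∑ k ∈ Finset.range n, (jacobiExpr a b u k * v k - u k * jacobiExpr a b v k)
      = wronskian a (site u) (site v) n := by
  induction n with
  | zero => simp [wronskian, site]
  | succ n ih =>
    rw [Finset.sum_range_succ, ih]
    simp [wronskian, jacobiExpr, site]
    ring

theorem star_jacobiExpr (u : ℕ → ℂ) (k : ℕ) :
    star (jacobiExpr a b u k) = jacobiExpr a b (fun j => star (u j)) k := by
  cases k <;> simp [jacobiExpr, site]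

variable {a b}

/-- The defect of symmetry is the limit `c` of the Wronskians. If `c ≠ 0`, then `1/|a(n)|` is
eventually dominated by a summable combination of `|u|²` and `|v|²`, contradicting divergence. -/
theorem isSymmetricOn_halfLineOp (ha : ∀ n, a n ≠ 0) (hsum : ¬ Summable fun n => |a n|⁻¹) :
    IsSymmetricOn (halfLineOp a b) := by
  intro u v
  set u' : ℕ → ℂ := fun k => star ((u : HalfLine) k) with hu'
  have hW : Tendsto (wronskian a (site u') (site (v : HalfLine))) atTop
      (𝓝 (inner ℂ (halfLineOp a b u) (v : HalfLine)
        - inner ℂ (u : HalfLine) (halfLineOp a b v))) := by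
    have h := ((lp.hasSum_inner (𝕜 := ℂ) (halfLineOp a b u) (v : HalfLine)).sub
      (lp.hasSum_inner (𝕜 := ℂ) (u : HalfLine) (halfLineOp a b v))).tendsto_sum_nat
    refine h.congr fun n => ?_
    rw [← sum_jacobiExpr_mul_sub a b]
    refine Finset.sum_congr rfl fun k _ => ?_
    rw [← star_jacobiExpr, halfLineOp_apply, halfLineOp_apply]
    simp [hu', mul_comm]
  rw [← sub_eq_zero]
  by_contra hc
  apply hsum
  set c := inner ℂ (halfLineOp a b u) (v : HalfLine)
        - inner ℂ (u : HalfLine) (halfLineOp a b v)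
  have hcpos : 0 < ‖c‖ := norm_pos_iff.2 hc
  have hu2 : ∀ n, ‖site u' n‖ = ‖site (u : HalfLine) n‖ := by
    intro n
    cases n <;> simp [site, hu']
  have hbd : ∀ᶠ n in atTop, |a n|⁻¹ ≤ ‖c‖⁻¹ * (‖site (u : HalfLine) (n + 1)‖ ^ 2
      + ‖site (v : HalfLine) n‖ ^ 2 + ‖site (u : HalfLine) n‖ ^ 2
      + ‖site (v : HalfLine) (n + 1)‖ ^ 2) := by
    filter_upwards [hW.norm.eventually_const_lt (show ‖c‖ / 2 < ‖c‖ by linarith)] with n hn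
    have hpos : 0 < |a n| := abs_pos.2 (ha n)
    have h1 : ‖wronskian a (site u') (site (v : HalfLine)) n‖ ≤ |a n| *
        (‖site (u : HalfLine) (n + 1)‖ * ‖site (v : HalfLine) n‖
          + ‖site (u : HalfLine) n‖ * ‖site (v : HalfLine) (n + 1)‖) := by
      rw [wronskian, norm_mul, Complex.norm_real, Real.norm_eq_abs]
      gcongr
      refine (norm_sub_le _ _).trans_eq ?_
      rw [norm_mul, norm_mul, hu2, hu2]
    rw [← div_eq_inv_mul, inv_eq_one_div, div_le_div_iff₀ hpos hcpos]
    nlinarith [sq_nonneg (‖site (u : HalfLine) (n + 1)‖ - ‖site (v : HalfLine) n‖),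
      sq_nonneg (‖site (u : HalfLine) n‖ - ‖site (v : HalfLine) (n + 1)‖)]
  have hs : Summable fun n => ‖c‖⁻¹ * (‖site (u : HalfLine) (n + 1)‖ ^ 2
      + ‖site (v : HalfLine) n‖ ^ 2 + ‖site (u : HalfLine) n‖ ^ 2
      + ‖site (v : HalfLine) (n + 1)‖ ^ 2) := by
    refine Summable.mul_left _ (((Summable.add ?_ ?_).add ?_).add ?_)
    · exact (summable_nat_add_iff 1).2 (summable_norm_sq_site (u : HalfLine))
    · exact summable_norm_sq_site _
    · exact summable_norm_sq_site _
    · exact (summable_nat_add_iff 1).2 (summable_norm_sq_site (v : HalfLine))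
  obtain ⟨N, hN⟩ := eventually_atTop.1 hbd
  rw [← summable_nat_add_iff N] at hs ⊢
  exact Summable.of_nonneg_of_le (fun n => by positivity) (fun n => hN _ (by omega)) hs

theorem halfLineOp_closed {x y : HalfLine} {X : ℕ → (halfLineOp a b).domain}
    (hX : Tendsto (fun n => (X n : HalfLine)) atTop (𝓝 x))
    (hY : Tendsto (fun n => halfLineOp a b (X n)) atTop (𝓝 y)) :
    ∃ hx : x ∈ (halfLineOp a b).domain, halfLineOp a b ⟨x, hx⟩ = y := by
  have h : jacobiExpr a b x = y := by
    funext k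
    have h1 : Tendsto (fun n => jacobiExpr a b (X n : HalfLine) k) atTop
        (𝓝 (jacobiExpr a b x k)) := by
      simp only [← inner_halfLineOp_delta]
      exact ((innerSL ℂ _).continuous.tendsto x).comp hX
    have h2 : Tendsto (fun n => jacobiExpr a b (X n : HalfLine) k) atTop (𝓝 (y k)) := by
      simp only [← halfLineOp_apply, ← inner_delta]
      exact ((innerSL ℂ _).continuous.tendsto y).comp hY
    exact tendsto_nhds_unique h1 h2
  have hx : x ∈ (halfLineOp a b).domain := by
    change Memℓp (jacobiExpr a b x) 2
    rw [h]
    exact lp.memℓp y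
  exact ⟨hx, lp.ext h⟩

/-- A vector `w` orthogonal to the range, tested on the `δ_k`, solves `H w = -is w` and lies in the
maximal domain, hence is 0 by symmetry. So the range is dense, and it is closed by
`IsSymmetricOn.norm_le` and closedness of `H`. -/
theorem halfLineOp_surjective (ha : ∀ n, a n ≠ 0) (hsum : ¬ Summable fun n => |a n|⁻¹) (s : ℝ)
    (h0 : s ≠ 0) (y : HalfLine) :
    ∃ x : (halfLineOp a b).domain, halfLineOp a b x - (Complex.I * s) • (x : HalfLine) = y := by
  have hs := isSymmetricOn_halfLineOp (b := b) ha hsum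
  let L : (halfLineOp a b).domain →ₗ[ℂ] HalfLine :=
    (halfLineOp a b).toFun - (Complex.I * s) • (halfLineOp a b).domain.subtype
  have hL : ∀ x, L x = halfLineOp a b x - (Complex.I * s) • (x : HalfLine) := fun x => rfl
  have hdense : (LinearMap.range L).topologicalClosure = ⊤ := by
    rw [Submodule.topologicalClosure_eq_top_iff, Submodule.eq_bot_iff]
    intro w hw
    have hw' : jacobiExpr a b w = ((Complex.I * (-s : ℝ)) • w : HalfLine) := by
      funext k
      have h1 := (Submodule.mem_orthogonal _ _).1 hw _
        (LinearMap.mem_range_self L ⟨delta k, delta_mem_domain a b k⟩)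
      rw [hL, inner_sub_left, inner_halfLineOp_delta, inner_smul_left, inner_delta,
        sub_eq_zero] at h1
      rw [h1, lp.coeFn_smul, Pi.smul_apply]
      simp
    have hwd : w ∈ (halfLineOp a b).domain := by
      change Memℓp (jacobiExpr a b w) 2
      rw [hw']
      exact lp.memℓp _
    have h2 : halfLineOp a b ⟨w, hwd⟩ = (Complex.I * (-s : ℝ)) • w := lp.ext hw'
    have h3 := hs.norm_le (neg_ne_zero.2 h0) ⟨w, hwd⟩
    rw [h2, sub_self, norm_zero, mul_zero, norm_le_zero_iff] at h3
    exact h3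
  have hy : y ∈ closure (LinearMap.range L : Set HalfLine) := by
    rw [← Submodule.topologicalClosure_coe, hdense]
    trivial
  obtain ⟨Y, hYmem, hY⟩ := mem_closure_iff_seq_limit.1 hy
  choose X hX using hYmem
  have hcauchy : CauchySeq fun n => (X n : HalfLine) := by
    have hYc := hY.cauchySeq
    rw [Metric.cauchySeq_iff'] at hYc ⊢
    intro ε hε
    have hspos : 0 < |s| := abs_pos.2 h0
    obtain ⟨N, hN⟩ := hYc (|s| * ε) (by positivity)
    refine ⟨N, fun n hn => ?_⟩
    have h1 := hs.norm_le h0 (X n - X N)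
    rw [← hL, map_sub, hX, hX, ← dist_eq_norm] at h1
    rw [dist_eq_norm]
    refine h1.trans_lt ?_
    rw [inv_mul_lt_iff₀ hspos]
    exact hN n hn
  obtain ⟨x, hx⟩ := cauchySeq_tendsto_of_complete hcauchy
  obtain ⟨hxd, hHx⟩ := halfLineOp_closed (a := a) (b := b) (y := y + (Complex.I * s) • x) hx (by
    have : Tendsto (fun n => Y n + (Complex.I * s) • (X n : HalfLine)) atTop
        (𝓝 (y + (Complex.I * s) • x)) := hY.add (hx.const_smul _)
    refine this.congr fun n => ?_
    rw [← hX, hL]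
    abel)
  refine ⟨⟨x, hxd⟩, ?_⟩
  rw [hHx]
  simp

theorem isUnitaryGroupOf_propagator (ha : ∀ n, a n ≠ 0) (hsum : ¬ Summable fun n => |a n|⁻¹) :
    IsUnitaryGroupOf (halfLineOp a b) (propagator (halfLineOp a b)) := by
  have h := exists_isUnitaryGroupOf (dense_domain a b) (isSymmetricOn_halfLineOp ha hsum)
    (halfLineOp_surjective ha hsum)
  rw [propagator, dif_pos h]
  exact h.choose_spec

theorem isSpectralMeasure_spectralMeasure (ha : ∀ n, a n ≠ 0)
    (hsum : ¬ Summable fun n => |a n|⁻¹) (ψ : HalfLine) :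
    IsSpectralMeasure (halfLineOp a b) ψ (spectralMeasure (halfLineOp a b) ψ) := by
  have h := exists_isSpectralMeasure (isSymmetricOn_halfLineOp (b := b) ha hsum)
    (halfLineOp_surjective ha hsum) ψ
  rw [spectralMeasure, dif_pos h]
  exact h.choose_spec

end

section

/-! ### Truncated norms as weighted sums -/

/-- The weight of the site `i + 1` in `‖·‖²_L`. -/
def weight (L : ℝ) (i : ℕ) : ℝ := min 1 (max 0 (L - i))

theorem weight_nonneg (L : ℝ) (i : ℕ) : 0 ≤ weight L i := le_min zero_le_one (le_max_left _ _)

theorem weight_mono (i : ℕ) : Monotone fun L => weight L i := fun _ _ h =>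
  min_le_min le_rfl (max_le_max le_rfl (sub_le_sub_right h _))

theorem continuous_weight (i : ℕ) : Continuous fun L => weight L i := by
  unfold weight; fun_prop

theorem weight_eq_one {L : ℝ} {i : ℕ} (h : (i : ℝ) + 1 ≤ L) : weight L i = 1 :=
  min_eq_left (le_max_of_le_right (by linarith))

theorem weight_eq_zero {L : ℝ} {i : ℕ} (h : L ≤ i) : weight L i = 0 := by
  rw [weight, max_eq_left (by linarith), min_eq_right zero_le_one]

/-- The freedom in `M` lets one finite sum serve a whole interval of `L`, as monotonicity and
continuity in `L` require. -/
theorem normSqL_eq_sum (φ : ℕ → ℂ) {L : ℝ} (hL : 0 ≤ L) {M : ℕ} (hM : ⌊L⌋₊ < M) :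
    normSqL φ L = ∑ i ∈ Finset.range M, weight L i * ‖φ (i + 1)‖ ^ 2 := by
  have h1 : ∑ i ∈ Finset.range M, weight L i * ‖φ (i + 1)‖ ^ 2
      = ∑ i ∈ Finset.range (⌊L⌋₊ + 1), weight L i * ‖φ (i + 1)‖ ^ 2 := by
    symm
    apply Finset.sum_subset (Finset.range_subset_range.2 hM)
    intro i _ hi
    have h2 : ⌊L⌋₊ + 1 ≤ i := by simpa using hi
    have h3 : ((⌊L⌋₊ : ℝ) + 1) ≤ i := by exact_mod_cast h2
    rw [weight_eq_zero ((Nat.lt_floor_add_one L).le.trans h3), zero_mul]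
  have h4 : weight L ⌊L⌋₊ = L - ⌊L⌋₊ := by
    have h5 := Nat.floor_le hL
    have h6 := Nat.lt_floor_add_one L
    rw [weight, max_eq_right (by linarith), min_eq_right (by linarith)]
  rw [h1, Finset.sum_range_succ, normSqL, h4]
  congr 1
  rw [Finset.range_eq_Ico, ← Finset.Ico_add_one_right_eq_Icc]
  rw [← Finset.sum_Ico_add' (fun n => ‖φ n‖ ^ 2) 0 ⌊L⌋₊ 1]
  refine Finset.sum_congr rfl fun i hi => ?_
  have h7 : i + 1 ≤ ⌊L⌋₊ := (Finset.mem_Ico.1 hi).2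
  have h8 : ((i : ℝ) + 1) ≤ ⌊L⌋₊ := by exact_mod_cast h7
  rw [weight_eq_one (h8.trans (Nat.floor_le hL)), one_mul]

theorem normSqL_nonneg (φ : ℕ → ℂ) {L : ℝ} (hL : 0 ≤ L) : 0 ≤ normSqL φ L := by
  rw [normSqL_eq_sum φ hL (Nat.lt_succ_self _)]
  exact Finset.sum_nonneg fun i _ => mul_nonneg (weight_nonneg L i) (by positivity)

theorem normSqL_mono (φ : ℕ → ℂ) {L L' : ℝ} (hL : 0 ≤ L) (h : L ≤ L') :
    normSqL φ L ≤ normSqL φ L' := by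
  rw [normSqL_eq_sum φ hL (Nat.lt_succ_of_le (Nat.floor_mono h)),
    normSqL_eq_sum φ (hL.trans h) (Nat.lt_succ_self _)]
  exact Finset.sum_le_sum fun i _ => mul_le_mul_of_nonneg_right (weight_mono i h) (by positivity)

theorem normSqL_zero (φ : ℕ → ℂ) : normSqL φ 0 = 0 := by simp [normSqL]

theorem sum_range_le_normSqL (φ : ℕ → ℂ) {L : ℝ} {N : ℕ} (hN : (N : ℝ) ≤ L) :
    ∑ i ∈ Finset.range N, ‖φ (i + 1)‖ ^ 2 ≤ normSqL φ L := by
  have hL : 0 ≤ L := (Nat.cast_nonneg N).trans hN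
  have h1 : N ≤ ⌊L⌋₊ := Nat.le_floor hN
  rw [normSqL_eq_sum φ hL (Nat.lt_succ_self _)]
  calc ∑ i ∈ Finset.range N, ‖φ (i + 1)‖ ^ 2
      = ∑ i ∈ Finset.range N, weight L i * ‖φ (i + 1)‖ ^ 2 := by
        refine Finset.sum_congr rfl fun i hi => ?_
        have h2 : i + 1 ≤ N := Finset.mem_range.1 hi
        have h3 : (i : ℝ) + 1 ≤ N := by exact_mod_cast h2
        rw [weight_eq_one (h3.trans hN), one_mul]
    _ ≤ _ := Finset.sum_le_sum_of_subset_of_nonneg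
        (Finset.range_subset_range.2 (by omega))
        fun i _ _ => mul_nonneg (weight_nonneg L i) (by positivity)

/-! ### Real solutions -/

variable (a b : ℕ → ℝ)

/-- The solution `u_θ(n, E)` at a real energy `E`. -/
def realSolution (θ E : ℝ) : ℕ → ℝ
  | 0 => Real.sin θ
  | 1 => Real.cos θ
  | n + 2 => ((E - b (n + 1)) * realSolution θ E (n + 1) - a n * realSolution θ E n) / a (n + 1)

theorem solution_ofReal (θ E : ℝ) (n : ℕ) :
    solution a b θ E n = (realSolution a b θ E n : ℂ) := by
  induction n using Nat.twoStepInduction with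
  | zero => simp [solution, realSolution]
  | one => simp [solution, realSolution]
  | more n h0 h1 =>
    rw [solution, realSolution, h0, h1]
    push_cast
    ring

theorem realSolution_eq (θ E : ℝ) (n : ℕ) : realSolution a b θ E n =
    Real.cos θ * realSolution a b 0 E n + Real.sin θ * realSolution a b (Real.pi / 2) E n := by
  induction n using Nat.twoStepInduction with
  | zero => simp [realSolution]
  | one => simp [realSolution]
  | more n h0 h1 =>
    rw [realSolution, h0, h1, realSolution, realSolution]
    ring

/-- `u` solves the difference equation at the energy `z`. -/
def IsSolution (z : ℂ) (u : ℕ → ℂ) : Prop :=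
  ∀ n, a (n + 1) * u (n + 2) + a n * u n + b (n + 1) * u (n + 1) = z * u (n + 1)

variable {a b}

theorem isSolution_realSolution (ha : ∀ n, a n ≠ 0) (θ E : ℝ) :
    IsSolution a b E fun n => (realSolution a b θ E n : ℂ) := by
  intro n
  have h : a (n + 1) * realSolution a b θ E (n + 2) =
      (E - b (n + 1)) * realSolution a b θ E (n + 1) - a n * realSolution a b θ E n := by
    rw [realSolution, mul_div_cancel₀ _ (ha (n + 1))]
  have h' : (a (n + 1) : ℂ) * realSolution a b θ E (n + 2) =
      (E - b (n + 1)) * realSolution a b θ E (n + 1) - a n * realSolution a b θ E n := by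
    exact_mod_cast h
  rw [h']
  ring

theorem IsSolution.wronskian_succ {z w : ℂ} {u v : ℕ → ℂ} (hu : IsSolution a b z u)
    (hv : IsSolution a b w v) (n : ℕ) :
    wronskian a u v (n + 1) = wronskian a u v n + (z - w) * (u (n + 1) * v (n + 1)) := by
  unfold wronskian
  linear_combination v (n + 1) * hu n - u (n + 1) * hv n

theorem IsSolution.wronskian_eq {z w : ℂ} {u v : ℕ → ℂ} (hu : IsSolution a b z u)
    (hv : IsSolution a b w v) (n : ℕ) :
    wronskian a u v n = wronskian a u v 0
      + (z - w) * ∑ i ∈ Finset.range n, u (i + 1) * v (i + 1) := by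
  induction n with
  | zero => simp
  | succ n ih =>
    rw [hu.wronskian_succ hv, ih, Finset.sum_range_succ]
    ring

theorem wronskian_realSolution (h0 : a 0 = 1) (ha : ∀ n, a n ≠ 0) (α E : ℝ) (n : ℕ) :
    wronskian a (fun n => (realSolution a b α E n : ℂ))
      (fun n => (realSolution a b (α + Real.pi / 2) E n : ℂ)) n = 1 := by
  rw [(isSolution_realSolution ha α E).wronskian_eq (isSolution_realSolution ha _ E)]
  have h := Real.sin_sq_add_cos_sq α
  simp only [wronskian, realSolution, h0, Real.sin_add_pi_div_two, Real.cos_add_pi_div_two]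
  have h' : (Real.sin α : ℂ) ^ 2 + (Real.cos α : ℂ) ^ 2 = 1 := by exact_mod_cast h
  push_cast at h' ⊢
  linear_combination h'

/-- Diagonalisation of a binary quadratic form by a rotation. -/
theorem exists_rotation_diagonalizing (A B D : ℝ) : ∃ α : ℝ,
    (∀ θ, A * Real.cos θ ^ 2 + 2 * B * (Real.cos θ * Real.sin θ) + D * Real.sin θ ^ 2
      ≤ A * Real.cos α ^ 2 + 2 * B * (Real.cos α * Real.sin α) + D * Real.sin α ^ 2) ∧
    (∀ θ, A * Real.sin α ^ 2 - 2 * B * (Real.cos α * Real.sin α) + D * Real.cos α ^ 2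
      ≤ A * Real.cos θ ^ 2 + 2 * B * (Real.cos θ * Real.sin θ) + D * Real.sin θ ^ 2) ∧
    (A * Real.cos α ^ 2 + 2 * B * (Real.cos α * Real.sin α) + D * Real.sin α ^ 2) *
      (A * Real.sin α ^ 2 - 2 * B * (Real.cos α * Real.sin α) + D * Real.cos α ^ 2)
      = A * D - B ^ 2 ∧
    (D - A) * (Real.cos α * Real.sin α) + B * (Real.cos α ^ 2 - Real.sin α ^ 2) = 0 := by
  -- `(A - D)/2 + iB = R e^{2iα}`; on unit vectors the form has extreme values `(A + D)/2 ± R`.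
  obtain ⟨R, α, hR, hre, him⟩ : ∃ R α : ℝ, 0 ≤ R ∧
      R * (Real.cos α ^ 2 - Real.sin α ^ 2) = (A - D) / 2 ∧
      R * (2 * (Real.cos α * Real.sin α)) = B := by
    refine ⟨‖(⟨(A - D) / 2, B⟩ : ℂ)‖, Complex.arg ⟨(A - D) / 2, B⟩ / 2, norm_nonneg _, ?_, ?_⟩
    · have h := Complex.norm_mul_cos_arg ⟨(A - D) / 2, B⟩
      rw [← mul_div_cancel₀ (Complex.arg ⟨(A - D) / 2, B⟩) (two_ne_zero (α := ℝ)),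
        Real.cos_two_mul'] at h
      exact h
    · have h := Complex.norm_mul_sin_arg ⟨(A - D) / 2, B⟩
      rw [← mul_div_cancel₀ (Complex.arg ⟨(A - D) / 2, B⟩) (two_ne_zero (α := ℝ)),
        Real.sin_two_mul] at h
      rw [mul_comm (Real.cos _), ← mul_assoc 2]
      exact h
  have hα := Real.sin_sq_add_cos_sq α
  set c := Real.cos α
  set s := Real.sin α
  have hA : A = (A + D) / 2 + R * (c ^ 2 - s ^ 2) := by rw [hre]; ring
  have hD : D = (A + D) / 2 - R * (c ^ 2 - s ^ 2) := by rw [hre]; ring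
  set m := (A + D) / 2
  have hq : ∀ x y : ℝ, y ^ 2 + x ^ 2 = 1 → A * x ^ 2 + 2 * B * (x * y) + D * y ^ 2
      = m + R * (2 * (c * x + s * y) ^ 2 - 1) := by
    intro x y h
    rw [hA, hD, ← him]
    have hc : c ^ 2 = 1 - s ^ 2 := by linarith
    have hx : x ^ 2 = 1 - y ^ 2 := by linarith
    have : (c * x + s * y) ^ 2 = c ^ 2 * x ^ 2 + 2 * (c * x * (s * y)) + s ^ 2 * y ^ 2 := by ring
    rw [this, hc, hx]
    ring
  have hbd : ∀ x y : ℝ, y ^ 2 + x ^ 2 = 1 → (c * x + s * y) ^ 2 ≤ 1 := by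
    intro x y h
    nlinarith [sq_nonneg (c * y - s * x)]
  have hmax : A * c ^ 2 + 2 * B * (c * s) + D * s ^ 2 = m + R := by
    rw [hq c s hα]
    have : c * c + s * s = 1 := by linarith
    rw [this]; ring
  have hmin : A * s ^ 2 - 2 * B * (c * s) + D * c ^ 2 = m - R := by
    have := hq (-s) c (by linarith)
    have e : c * -s + s * c = 0 := by ring
    rw [e] at this
    linarith
  refine ⟨α, fun θ => ?_, fun θ => ?_, ?_, ?_⟩
  · rw [hmax, hq _ _ (Real.sin_sq_add_cos_sq θ)]
    nlinarith [hbd _ _ (Real.sin_sq_add_cos_sq θ)]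
  · rw [hmin, hq _ _ (Real.sin_sq_add_cos_sq θ)]
    nlinarith [sq_nonneg (c * Real.cos θ + s * Real.sin θ)]
  · rw [hmax, hmin]
    have hone : (c ^ 2 - s ^ 2) ^ 2 + (2 * (c * s)) ^ 2 = 1 := by
      have : (c ^ 2 - s ^ 2) ^ 2 + (2 * (c * s)) ^ 2 = (s ^ 2 + c ^ 2) ^ 2 := by ring
      rw [this, hα]; ring
    rw [hA, hD, ← him]
    linear_combination R ^ 2 * hone
  · rw [show D - A = -(2 * (R * (c ^ 2 - s ^ 2))) by rw [hre]; ring, ← him]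
    ring

/-- The inner product belonging to `‖·‖_L`, for real sequences, as a sum of `M` terms. -/
def weightedInner (M : ℕ) (L : ℝ) (f g : ℕ → ℝ) : ℝ :=
  ∑ i ∈ Finset.range M, weight L i * (f (i + 1) * g (i + 1))

theorem normSqL_ofReal (f : ℕ → ℝ) {L : ℝ} (hL : 0 ≤ L) {M : ℕ} (hM : ⌊L⌋₊ < M) :
    normSqL (fun n => (f n : ℂ)) L = weightedInner M L f f := by
  rw [normSqL_eq_sum _ hL hM]
  refine Finset.sum_congr rfl fun i _ => ?_
  rw [Complex.norm_real, Real.norm_eq_abs, sq_abs, sq]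

variable (a b) in
theorem normSqL_solution (θ E : ℝ) {L : ℝ} (hL : 0 ≤ L) {M : ℕ} (hM : ⌊L⌋₊ < M) :
    normSqL (solution a b θ E) L =
      weightedInner M L (realSolution a b 0 E) (realSolution a b 0 E) * Real.cos θ ^ 2
      + 2 * weightedInner M L (realSolution a b 0 E) (realSolution a b (Real.pi / 2) E)
        * (Real.cos θ * Real.sin θ)
      + weightedInner M L (realSolution a b (Real.pi / 2) E) (realSolution a b (Real.pi / 2) E)
        * Real.sin θ ^ 2 := by
  have h : solution a b θ E = fun n => (realSolution a b θ E n : ℂ) :=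
    funext (solution_ofReal a b θ E)
  rw [h, normSqL_ofReal _ hL hM]
  simp only [weightedInner, Finset.sum_mul, Finset.mul_sum, ← Finset.sum_add_distrib]
  refine Finset.sum_congr rfl fun i _ => ?_
  rw [realSolution_eq]
  ring

variable (a b) in
/-- The extremal solutions for `‖·‖_L`: they belong to orthogonal boundary conditions, and they are
orthogonal for the inner product of `‖·‖_L`. -/
theorem exists_extremal_angle (E : ℝ) {L : ℝ} (hL : 0 ≤ L) {M : ℕ} (hM : ⌊L⌋₊ < M) : ∃ α : ℝ,
    maxMinProduct a b E L =
      normL (solution a b α E) L * normL (solution a b (α + Real.pi / 2) E) L ∧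
    weightedInner M L (realSolution a b α E) (realSolution a b (α + Real.pi / 2) E) = 0 ∧
    normSqL (solution a b α E) L * normSqL (solution a b (α + Real.pi / 2) E) L =
      weightedInner M L (realSolution a b 0 E) (realSolution a b 0 E) *
      weightedInner M L (realSolution a b (Real.pi / 2) E) (realSolution a b (Real.pi / 2) E)
      - weightedInner M L (realSolution a b 0 E) (realSolution a b (Real.pi / 2) E) ^ 2 := by
  obtain ⟨α, h1, h2, h3, h4⟩ := exists_rotation_diagonalizing
    (weightedInner M L (realSolution a b 0 E) (realSolution a b 0 E))
    (weightedInner M L (realSolution a b 0 E) (realSolution a b (Real.pi / 2) E))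
    (weightedInner M L (realSolution a b (Real.pi / 2) E) (realSolution a b (Real.pi / 2) E))
  have hmin : normSqL (solution a b (α + Real.pi / 2) E) L =
      weightedInner M L (realSolution a b 0 E) (realSolution a b 0 E) * Real.sin α ^ 2
      - 2 * weightedInner M L (realSolution a b 0 E) (realSolution a b (Real.pi / 2) E)
        * (Real.cos α * Real.sin α)
      + weightedInner M L (realSolution a b (Real.pi / 2) E) (realSolution a b (Real.pi / 2) E)
        * Real.cos α ^ 2 := by
    rw [normSqL_solution a b _ E hL hM, Real.cos_add_pi_div_two, Real.sin_add_pi_div_two]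
    ring
  have hsup : ∀ θ, normL (solution a b θ E) L ≤ normL (solution a b α E) L := by
    intro θ
    apply Real.sqrt_le_sqrt
    rw [normSqL_solution a b θ E hL hM, normSqL_solution a b α E hL hM]
    exact h1 θ
  have hinf : ∀ θ, normL (solution a b (α + Real.pi / 2) E) L ≤ normL (solution a b θ E) L := by
    intro θ
    apply Real.sqrt_le_sqrt
    rw [normSqL_solution a b θ E hL hM, hmin]
    exact h2 θ
  refine ⟨α, ?_, ?_, ?_⟩
  · rw [maxMinProduct]
    congr 1
    · exact le_antisymm (ciSup_le hsup) (le_ciSup ⟨_, Set.forall_mem_range.2 hsup⟩ α)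
    · exact le_antisymm (ciInf_le ⟨_, Set.forall_mem_range.2 hinf⟩ (α + Real.pi / 2))
        (le_ciInf hinf)
  · rw [← h4]
    simp only [weightedInner, Finset.sum_mul, ← Finset.sum_sub_distrib,
      ← Finset.sum_add_distrib]
    refine Finset.sum_congr rfl fun i _ => ?_
    rw [realSolution_eq a b α, realSolution_eq a b (α + Real.pi / 2), Real.cos_add_pi_div_two,
      Real.sin_add_pi_div_two]
    ring
  · rw [normSqL_solution a b α E hL hM, hmin, h3]

-- The product of the extremal norms is the root of a Gram determinant. This removes the angle,
-- which depends on `L`, and so gives continuity in `L`.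
variable (a b) in
theorem maxMinProduct_eq_sqrt (E : ℝ) {L : ℝ} (hL : 0 ≤ L) {M : ℕ} (hM : ⌊L⌋₊ < M) :
    maxMinProduct a b E L = Real.sqrt
      (weightedInner M L (realSolution a b 0 E) (realSolution a b 0 E) *
      weightedInner M L (realSolution a b (Real.pi / 2) E) (realSolution a b (Real.pi / 2) E)
      - weightedInner M L (realSolution a b 0 E) (realSolution a b (Real.pi / 2) E) ^ 2) := by
  obtain ⟨α, h1, -, h3⟩ := exists_extremal_angle a b E hL hM
  rw [h1, ← h3, Real.sqrt_mul (normSqL_nonneg _ hL)]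
  rfl

variable (a b) in
theorem continuousOn_maxMinProduct (E : ℝ) :
    ContinuousOn (maxMinProduct a b E) (Set.Ici 0) := by
  intro x hx
  have hw : ∀ f g, Continuous fun L => weightedInner (⌊x + 1⌋₊ + 1) L f g := fun f g =>
    continuous_finsetSum _ fun i _ => (continuous_weight i).mul continuous_const
  refine ContinuousWithinAt.congr_of_eventuallyEq
    (f := fun L => Real.sqrt
      (weightedInner (⌊x + 1⌋₊ + 1) L (realSolution a b 0 E) (realSolution a b 0 E) *
      weightedInner (⌊x + 1⌋₊ + 1) L (realSolution a b (Real.pi / 2) E)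
        (realSolution a b (Real.pi / 2) E)
      - weightedInner (⌊x + 1⌋₊ + 1) L (realSolution a b 0 E)
        (realSolution a b (Real.pi / 2) E) ^ 2)) ?_ ?_ ?_
  · exact ((((hw _ _).mul (hw _ _)).sub ((hw _ _).pow 2)).sqrt).continuousWithinAt
  · filter_upwards [self_mem_nhdsWithin, mem_nhdsWithin_of_mem_nhds
      (Iio_mem_nhds (show x < x + 1 by linarith))] with L hL hLx
    exact maxMinProduct_eq_sqrt a b E hL (Nat.lt_succ_of_le (Nat.floor_mono (le_of_lt hLx)))
  · exact maxMinProduct_eq_sqrt a b E hx (Nat.lt_succ_of_le (Nat.floor_mono (by linarith)))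

/-- The truncated norms of two solutions with Wronskian `1` control `∑ 1/|a(n)|`. -/
theorem sum_inv_le_maxMinProduct (h0 : a 0 = 1) (ha : ∀ n, a n ≠ 0) (E : ℝ) (N : ℕ) :
    ∑ n ∈ Finset.range N, |a (n + 1)|⁻¹ ≤ 2 * maxMinProduct a b E (N + 1) := by
  have hL : (0 : ℝ) ≤ (N : ℝ) + 1 := by positivity
  obtain ⟨α, h1, -, -⟩ := exists_extremal_angle a b E hL (Nat.lt_succ_self _)
  rw [h1]
  set u := solution a b α E
  set v := solution a b (α + Real.pi / 2) E
  have hW : ∀ n, |a n|⁻¹ ≤ ‖u (n + 1)‖ * ‖v n‖ + ‖u n‖ * ‖v (n + 1)‖ := by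
    intro n
    have h := congrArg norm (wronskian_realSolution (b := b) h0 ha α E n)
    rw [wronskian, norm_mul, norm_one, Complex.norm_real, Real.norm_eq_abs] at h
    simp only [← solution_ofReal] at h
    rw [inv_eq_of_mul_eq_one_right h]
    refine (norm_sub_le _ _).trans_eq ?_
    rw [norm_mul, norm_mul]
  -- The factor `f` reaches the site `N + 1`, whence the length `N + 1`.
  have hcs : ∀ f g : ℕ → ℂ, ∑ n ∈ Finset.range N, ‖f (n + 2)‖ * ‖g (n + 1)‖
      ≤ normL f (N + 1) * normL g (N + 1) := by
    intro f g
    refine (Real.sum_mul_le_sqrt_mul_sqrt _ _ _).trans ?_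
    refine mul_le_mul (Real.sqrt_le_sqrt ?_) (Real.sqrt_le_sqrt ?_) (Real.sqrt_nonneg _)
      (Real.sqrt_nonneg _)
    · refine le_trans ?_ (sum_range_le_normSqL f (N := N + 1) (by push_cast; exact le_rfl))
      rw [Finset.sum_range_succ']
      exact le_add_of_nonneg_right (by positivity)
    · exact sum_range_le_normSqL g (N := N) (by linarith)
  calc ∑ n ∈ Finset.range N, |a (n + 1)|⁻¹
      ≤ ∑ n ∈ Finset.range N, (‖u (n + 2)‖ * ‖v (n + 1)‖ + ‖v (n + 2)‖ * ‖u (n + 1)‖) := by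
        refine Finset.sum_le_sum fun n _ => (hW (n + 1)).trans_eq ?_
        ring
    _ ≤ _ := by
        rw [Finset.sum_add_distrib]
        have := hcs u v
        have := hcs v u
        linarith

/-- When `∑ 1/|a(n)| = ∞`, the length scale solves its defining equation. -/
theorem exists_maxMinProduct_eq (h0 : a 0 = 1) (ha : ∀ n, a n ≠ 0)
    (hsum : ¬ Summable fun n => |a n|⁻¹) {T : ℝ} (hT : 0 < T) {E L : ℝ}
    (hL : lengthScale a b T⁻¹ E ≤ L) : ∃ L', 0 ≤ L' ∧ L' ≤ L ∧ maxMinProduct a b E L' = T := by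
  have hc := continuousOn_maxMinProduct a b E
  rw [lengthScale, inv_inv] at hL
  set S := {L : ℝ | 0 ≤ L ∧ maxMinProduct a b E L = T} with hS
  have hclosed : IsClosed S := by
    have := hc.preimage_isClosed_of_isClosed isClosed_Ici (isClosed_singleton (x := T))
    exact this
  -- An empty `S` would have the default infimum 0. The product is 0 at `L = 0` and unbounded, so it
  -- takes the value `T`; as `S` is closed, its infimum is attained.
  have hne : S.Nonempty := by
    have hdiv : ¬ Summable fun n => |a (n + 1)|⁻¹ := fun h => hsum ((summable_nat_add_iff 1).1 h)
    have htop := (not_summable_iff_tendsto_nat_atTop_of_nonneg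
      (fun n => inv_nonneg.2 (abs_nonneg _))).1 hdiv
    obtain ⟨N, hN⟩ := (htop.eventually_ge_atTop (2 * T)).exists
    have h1 : T ≤ maxMinProduct a b E (N + 1) := by
      have := sum_inv_le_maxMinProduct (b := b) h0 ha E N
      linarith
    have h2 : maxMinProduct a b E 0 = 0 := by
      simp [maxMinProduct, normL, normSqL_zero]
    have h3 : (0 : ℝ) ≤ (N : ℝ) + 1 := by positivity
    obtain ⟨x, hx, hxT⟩ := intermediate_value_Icc h3 (hc.mono Set.Icc_subset_Ici_self)
      (show T ∈ Set.Icc _ _ from ⟨by rw [h2]; exact hT.le, h1⟩)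
    exact ⟨x, hx.1, hxT⟩
  have hmem := hclosed.csInf_mem hne ⟨0, fun x hx => hx.1⟩
  exact ⟨sInf S, hmem.1, hL, hmem.2⟩

/-! ### Variation of parameters -/

theorem norm_sum_mul_sq_le (f g : ℕ → ℂ) {L : ℝ} {n : ℕ} (hn : (n : ℝ) ≤ L) :
    ‖∑ i ∈ Finset.range n, f (i + 1) * g (i + 1)‖ ^ 2 ≤ normSqL f L * normSqL g L := by
  have h1 : ‖∑ i ∈ Finset.range n, f (i + 1) * g (i + 1)‖
      ≤ ∑ i ∈ Finset.range n, ‖f (i + 1)‖ * ‖g (i + 1)‖ := by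
    refine (norm_sum_le _ _).trans_eq ?_
    simp
  have hL : 0 ≤ L := (Nat.cast_nonneg n).trans hn
  calc _ ≤ (∑ i ∈ Finset.range n, ‖f (i + 1)‖ * ‖g (i + 1)‖) ^ 2 := by gcongr
    _ ≤ _ := Finset.sum_mul_sq_le_sq_mul_sq _ _ _
    _ ≤ _ := by
      gcongr
      · exact normSqL_nonneg f hL
      · exact sum_range_le_normSqL f hn
      · exact sum_range_le_normSqL g hn

/-- In the basis `u, v` the coefficients of `g` are its Wronskians with `v` and `u`. From their
values at 0 they drift by `(z - E)` times partial sums of `g v` and `g u`, which Cauchy–Schwarz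
bounds. Applying `|x + y|² ≤ 2|x|² + 2|y|²` twice produces 2 and 8. -/
theorem normSqL_free_le {E z : ℂ} {u v g : ℕ → ℂ} (hu : IsSolution a b E u)
    (hv : IsSolution a b E v) (hg : IsSolution a b z g) (hW : ∀ n, wronskian a u v n = 1)
    {L : ℝ} (hL : 0 ≤ L) :
    normSqL (fun n => wronskian a g v 0 * u n - wronskian a g u 0 * v n) L ≤
      normSqL g L * (2 + 8 * ‖z - E‖ ^ 2 * (normSqL u L * normSqL v L)) := by
  set c := wronskian a g v 0
  set d := wronskian a g u 0
  set G := normSqL g L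
  set U := normSqL u L
  set V := normSqL v L
  have hG : 0 ≤ G := normSqL_nonneg g hL
  -- The drift at the site `i + 1` involves only the sites `1, …, i`, all of full weight, so the
  -- bound also covers the fractional last site.
  have hpt : ∀ i : ℕ, (i : ℝ) ≤ L → ‖c * u (i + 1) - d * v (i + 1)‖ ^ 2 ≤
      2 * ‖g (i + 1)‖ ^ 2 + 4 * ‖z - E‖ ^ 2 * G * (V * ‖u (i + 1)‖ ^ 2 + U * ‖v (i + 1)‖ ^ 2) := by
    intro i hi
    set X := ∑ j ∈ Finset.range i, g (j + 1) * v (j + 1)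
    set Y := ∑ j ∈ Finset.range i, g (j + 1) * u (j + 1)
    have hX : ‖X‖ ^ 2 ≤ G * V := norm_sum_mul_sq_le g v hi
    have hY : ‖Y‖ ^ 2 ≤ G * U := norm_sum_mul_sq_le g u hi
    have h1 : g (i + 1) = wronskian a g v i * u (i + 1) - wronskian a g u i * v (i + 1) := by
      have := hW i
      unfold wronskian at this ⊢
      linear_combination (-g (i + 1)) * this
    rw [hg.wronskian_eq hv, hg.wronskian_eq hu] at h1
    have h2 : c * u (i + 1) - d * v (i + 1) =
        g (i + 1) + (-((z - E) * X * u (i + 1)) + (z - E) * Y * v (i + 1)) := by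
      rw [h1]; ring
    have hsq : ∀ x y : ℂ, ‖x + y‖ ^ 2 ≤ 2 * ‖x‖ ^ 2 + 2 * ‖y‖ ^ 2 := by
      intro x y
      have := norm_add_le x y
      nlinarith [sq_nonneg (‖x‖ - ‖y‖), norm_nonneg (x + y)]
    have h3 := hsq (g (i + 1)) (-((z - E) * X * u (i + 1)) + (z - E) * Y * v (i + 1))
    have h4 := hsq (-((z - E) * X * u (i + 1))) ((z - E) * Y * v (i + 1))
    rw [norm_neg, norm_mul, norm_mul, norm_mul, norm_mul, mul_pow, mul_pow, mul_pow, mul_pow] at h4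
    have h5 : ‖z - E‖ ^ 2 * ‖X‖ ^ 2 * ‖u (i + 1)‖ ^ 2
        ≤ ‖z - E‖ ^ 2 * (G * V) * ‖u (i + 1)‖ ^ 2 := by gcongr
    have h6 : ‖z - E‖ ^ 2 * ‖Y‖ ^ 2 * ‖v (i + 1)‖ ^ 2
        ≤ ‖z - E‖ ^ 2 * (G * U) * ‖v (i + 1)‖ ^ 2 := by gcongr
    rw [h2]
    linarith
  calc normSqL (fun n => c * u n - d * v n) L
      = ∑ i ∈ Finset.range (⌊L⌋₊ + 1), weight L i * ‖c * u (i + 1) - d * v (i + 1)‖ ^ 2 :=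
        normSqL_eq_sum _ hL (Nat.lt_succ_self _)
    _ ≤ ∑ i ∈ Finset.range (⌊L⌋₊ + 1), weight L i * (2 * ‖g (i + 1)‖ ^ 2
          + 4 * ‖z - E‖ ^ 2 * G * (V * ‖u (i + 1)‖ ^ 2 + U * ‖v (i + 1)‖ ^ 2)) := by
        refine Finset.sum_le_sum fun i hi => ?_
        refine mul_le_mul_of_nonneg_left (hpt i ?_) (weight_nonneg L i)
        have h7 : i ≤ ⌊L⌋₊ := Nat.lt_succ_iff.1 (Finset.mem_range.1 hi)
        exact (Nat.cast_le.2 h7).trans (Nat.floor_le hL)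
    _ = 2 * G + 4 * ‖z - E‖ ^ 2 * G * (V * U + U * V) := by
        have hGs := normSqL_eq_sum g hL (Nat.lt_succ_self _)
        have hUs := normSqL_eq_sum u hL (Nat.lt_succ_self _)
        have hVs := normSqL_eq_sum v hL (Nat.lt_succ_self _)
        calc _ = 2 * ∑ i ∈ Finset.range (⌊L⌋₊ + 1), weight L i * ‖g (i + 1)‖ ^ 2
            + 4 * ‖z - E‖ ^ 2 * G * (V * ∑ i ∈ Finset.range (⌊L⌋₊ + 1), weight L i * ‖u (i + 1)‖ ^ 2
              + U * ∑ i ∈ Finset.range (⌊L⌋₊ + 1), weight L i * ‖v (i + 1)‖ ^ 2) := by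
              simp only [Finset.mul_sum, ← Finset.sum_add_distrib]
              exact Finset.sum_congr rfl fun i _ => by ring
          _ = _ := by rw [← hGs, ← hUs, ← hVs]
    _ = _ := by ring

end

/-! ### The lower bound for the Green function. -/

section

variable {a b : ℕ → ℝ}

/-- Pythagoras. Complex coefficients are allowed because `u, v` are real: the cross term is `-2 Re(c
d̄)` times their real inner product. -/
theorem normSqL_linear_combination {u v : ℕ → ℝ} {L : ℝ} (hL : 0 ≤ L)
    (huv : weightedInner (⌊L⌋₊ + 1) L u v = 0) (c d : ℂ) :
    normSqL (fun n => c * u n - d * v n) L =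
      ‖c‖ ^ 2 * normSqL (fun n => (u n : ℂ)) L + ‖d‖ ^ 2 * normSqL (fun n => (v n : ℂ)) L := by
  have h : ∀ x y : ℝ, ‖c * x - d * y‖ ^ 2 =
      ‖c‖ ^ 2 * (x * x) + ‖d‖ ^ 2 * (y * y) - 2 * (c.re * d.re + c.im * d.im) * (x * y) := by
    intro x y
    simp only [← Complex.normSq_eq_norm_sq, Complex.normSq_apply]
    simp
    ring
  rw [normSqL_ofReal u hL (Nat.lt_succ_self _), normSqL_ofReal v hL (Nat.lt_succ_self _),
    normSqL_eq_sum _ hL (Nat.lt_succ_self _)]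
  have h0 : ∑ i ∈ Finset.range (⌊L⌋₊ + 1), weight L i * ‖c * u (i + 1) - d * v (i + 1)‖ ^ 2
      = ‖c‖ ^ 2 * weightedInner (⌊L⌋₊ + 1) L u u + ‖d‖ ^ 2 * weightedInner (⌊L⌋₊ + 1) L v v
        - 2 * (c.re * d.re + c.im * d.im) * weightedInner (⌊L⌋₊ + 1) L u v := by
    simp only [h, weightedInner, Finset.mul_sum, ← Finset.sum_add_distrib,
      ← Finset.sum_sub_distrib]
    exact Finset.sum_congr rfl fun i _ => by ring
  rw [huv, mul_zero, sub_zero] at h0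
  exact h0

/-- A Jitomirskaya–Last type estimate: at the length scale `L⁺(E)` of the resolution `1/T`, the
Green function at energies near `E + i/T` is bounded below by the imaginary part of the Weyl
function. -/
theorem im_le_normSqL (h0 : a 0 = 1) (ha : ∀ n, a n ≠ 0) {T E L : ℝ} (hT : 0 < T) (hL : 0 ≤ L)
    (hP : maxMinProduct a b E L = T) {z : ℂ} (hz : ‖z - E‖ ^ 2 ≤ 2 / T ^ 2) {g : ℕ → ℂ}
    (hg : IsSolution a b z g) (hg0 : g 0 = -1) :
    T / 9 * |(g 1).im| ≤ normSqL g L := by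
  obtain ⟨α, h1, h2, -⟩ := exists_extremal_angle a b E hL (Nat.lt_succ_self _)
  set u := realSolution a b α E with hu
  set v := realSolution a b (α + Real.pi / 2) E with hv
  have hsu : solution a b α E = fun n => (u n : ℂ) := funext (solution_ofReal a b α E)
  have hsv : solution a b (α + Real.pi / 2) E = fun n => (v n : ℂ) :=
    funext (solution_ofReal a b _ E)
  rw [hP, hsu, hsv] at h1
  set U := normSqL (fun n => (u n : ℂ)) L
  set V := normSqL (fun n => (v n : ℂ)) L
  have hU : 0 ≤ U := normSqL_nonneg _ hL
  have hV : 0 ≤ V := normSqL_nonneg _ hL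
  have hUV : U * V = T ^ 2 := by
    rw [h1, mul_pow, normL, normL, Real.sq_sqrt hU, Real.sq_sqrt hV]
  have h3 := normSqL_free_le (isSolution_realSolution ha α E)
    (isSolution_realSolution ha (α + Real.pi / 2) E) hg (wronskian_realSolution h0 ha α E) hL
  rw [← hu, ← hv, normSqL_linear_combination hL h2] at h3
  set c := wronskian a g (fun n => (v n : ℂ)) 0 with hc
  set d := wronskian a g (fun n => (u n : ℂ)) 0 with hd
  have hG : 0 ≤ normSqL g L := normSqL_nonneg g hL
  -- `18 = 2 + 8 · 2`, from `U V = T²` and `|z - E|² T² ≤ 2`.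
  have h4 : normSqL g L * (2 + 8 * ‖z - E‖ ^ 2 * (U * V)) ≤ normSqL g L * 18 := by
    apply mul_le_mul_of_nonneg_left _ hG
    rw [hUV]
    have : ‖z - E‖ ^ 2 * T ^ 2 ≤ 2 / T ^ 2 * T ^ 2 := by gcongr
    rw [div_mul_cancel₀ _ (by positivity)] at this
    linarith
  -- `c = g(1) cos α - sin α` and `d = g(1) sin α + cos α`, so `Im(c d̄) = Im g(1)` for every `α`.
  have him : (g 1).im = c.im * d.re - c.re * d.im := by
    have hcs := Real.sin_sq_add_cos_sq α
    simp only [hc, hd, wronskian, hu, hv, realSolution, h0, hg0, Real.sin_add_pi_div_two,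
      Real.cos_add_pi_div_two]
    simp [-Complex.ofReal_sin, -Complex.ofReal_cos]
    linear_combination (-(g 1).im) * hcs
  have h5 : |(g 1).im| ≤ ‖c‖ * ‖d‖ := by
    have : (g 1).im = (c * (starRingEnd ℂ) d).im := by
      rw [him]; simp; ring
    rw [this]
    refine (Complex.abs_im_le_norm _).trans_eq ?_
    rw [norm_mul, RCLike.norm_conj]
  have h6 : 2 * (‖c‖ * ‖d‖) * T ≤ ‖c‖ ^ 2 * U + ‖d‖ ^ 2 * V := by
    have hsq := sq_nonneg (‖c‖ * Real.sqrt U - ‖d‖ * Real.sqrt V)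
    have e1 := Real.sq_sqrt hU
    have e2 := Real.sq_sqrt hV
    have e3 : T = Real.sqrt U * Real.sqrt V := h1
    rw [e3]
    have : (‖c‖ * Real.sqrt U - ‖d‖ * Real.sqrt V) ^ 2 = ‖c‖ ^ 2 * Real.sqrt U ^ 2
      + ‖d‖ ^ 2 * Real.sqrt V ^ 2 - 2 * (‖c‖ * ‖d‖) * (Real.sqrt U * Real.sqrt V) := by ring
    rw [e1, e2] at this
    linarith
  have h7 : 2 * |(g 1).im| * T ≤ 2 * (‖c‖ * ‖d‖) * T := by gcongr
  linarith

/-- The Green function, extended by `-1` to the site `0`, solves the difference equation. -/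
theorem isSolution_green (h0 : a 0 = 1) {z : ℂ} {φ : (halfLineOp a b).domain}
    (hφ : halfLineOp a b φ - z • (φ : HalfLine) = delta1) :
    IsSolution a b z fun n => match n with
      | 0 => -1
      | n + 1 => (φ : HalfLine) n := by
  intro n
  have h : jacobiExpr a b (φ : HalfLine) n - z * (φ : HalfLine) n = delta 0 n := by
    rw [delta_zero, ← hφ]
    rfl
  rw [delta_apply] at h
  cases n with
  -- As `a(0) = 1`, the value `-1` at the site 0 supplies the source `δ₁`.
  | zero =>
    simp [jacobiExpr, site] at h
    simp [h0]
    linear_combination h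
  | succ n =>
    simp [jacobiExpr, site] at h
    simp
    linear_combination h

theorem im_resolvent_le_normSqL (h0 : a 0 = 1) (ha : ∀ n, a n ≠ 0)
    (hsum : ¬ Summable fun n => |a n|⁻¹) {T E L : ℝ} (hT : 0 < T)
    (hE : lengthScale a b T⁻¹ E ≤ L) {z : ℂ} (hz : ‖z - E‖ ^ 2 ≤ 2 / T ^ 2)
    {φ : (halfLineOp a b).domain} (hφ : halfLineOp a b φ - z • (φ : HalfLine) = delta1) :
    T / 9 * |((φ : HalfLine) 0).im| ≤ normSqL (site (φ : HalfLine)) L := by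
  obtain ⟨L', hL0, hL', hP⟩ := exists_maxMinProduct_eq (b := b) h0 ha hsum hT hE
  have h := im_le_normSqL h0 ha hT hL0 hP hz (isSolution_green h0 hφ) rfl
  refine h.trans (le_trans (le_of_eq ?_) (normSqL_mono _ hL0 hL'))
  rw [normSqL_eq_sum _ hL0 (Nat.lt_succ_self _), normSqL_eq_sum _ hL0 (Nat.lt_succ_self _)]
  rfl

end

/-! ### Plancherel's theorem for the pointwise Fourier transform -/

section Plancherel

open MeasureTheory FourierTransform SchwartzMap
open scoped ContDiff

/-- The `L²` transform and the Fourier integral have the same pairing with every test function, by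
moving the transform onto the test function on both sides. -/
theorem coeFn_fourier_toLp {f : ℝ → ℂ} (h1 : Integrable f) (h2 : MemLp f 2) :
    (𝓕 (h2.toLp f) : Lp ℂ 2 (volume : Measure ℝ)) =ᵐ[volume] 𝓕 f := by
  have hcont : Continuous (𝓕 f) := VectorFourier.fourierIntegral_continuous
    Real.continuous_fourierChar (by exact continuous_inner) h1
  apply ae_eq_of_integral_contDiff_smul_eq
  · exact (Lp.memLp _).locallyIntegrable (by norm_num)
  · exact hcont.locallyIntegrable
  intro g g_smooth g_cpt
  have hg₁ : HasCompactSupport (Complex.ofRealCLM ∘ g) := g_cpt.comp_left rfl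
  have hg₂ : ContDiff ℝ ∞ (Complex.ofRealCLM ∘ g) := by fun_prop
  set G : 𝓢(ℝ, ℂ) := hg₁.toSchwartzMap hg₂ with hG
  have hGx : ∀ x, G x = (g x : ℂ) := fun x => by simp [hG]
  have e1 : ∫ x, g x • (𝓕 (h2.toLp f) : Lp ℂ 2 (volume : Measure ℝ)) x =
      Lp.toTemperedDistribution (𝓕 (h2.toLp f)) G := by
    rw [Lp.toTemperedDistribution_apply]
    simp [hGx]
  rw [e1, ← Lp.fourier_toTemperedDistribution_eq, TemperedDistribution.fourier_apply,
    Lp.toTemperedDistribution_apply]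
  have e2 : ∫ x, (𝓕 G) x • (h2.toLp f) x = ∫ x, (𝓕 G) x • f x := by
    refine integral_congr_ae ?_
    filter_upwards [h2.coeFn_toLp] with x hx
    rw [hx]
  rw [e2]
  have e3 := VectorFourier.integral_fourierIntegral_smul_eq_flip (L := innerₗ ℝ) (f := G)
    (μ := volume) (ν := volume) Real.continuous_fourierChar (by exact continuous_inner)
    G.integrable h1
  rw [flip_innerₗ] at e3
  refine Eq.trans e3 ?_
  refine integral_congr_ae (Eventually.of_forall fun x => ?_)
  simp only [hGx]
  rfl

theorem plancherel {f : ℝ → ℂ} (h1 : Integrable f) (h2 : MemLp f 2) :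
    Integrable (fun ξ => ‖𝓕 f ξ‖ ^ 2) ∧ ∫ ξ, ‖𝓕 f ξ‖ ^ 2 = ∫ t, ‖f t‖ ^ 2 := by
  have hae := coeFn_fourier_toLp h1 h2
  have hmem : MemLp (𝓕 f) 2 := (memLp_congr_ae hae).1 (Lp.memLp _)
  refine ⟨hmem.integrable_norm_pow two_ne_zero, ?_⟩
  have hnorm : ∀ g : Lp ℂ 2 (volume : Measure ℝ), ‖g‖ ^ 2 = ∫ x, ‖g x‖ ^ 2 := by
    intro g
    have h := L2.inner_def (𝕜 := ℂ) g g
    simp only [inner_self_eq_norm_sq_to_K] at h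
    have h' : ((‖g‖ ^ 2 : ℝ) : ℂ) = ((∫ x, ‖g x‖ ^ 2 : ℝ) : ℂ) := by
      rw [← integral_complex_ofReal]
      simpa using h
    exact_mod_cast h'
  have h3 := hnorm (𝓕 (h2.toLp f))
  rw [Lp.norm_fourier_eq, hnorm] at h3
  have h4 : ∫ x, ‖h2.toLp f x‖ ^ 2 = ∫ x, ‖f x‖ ^ 2 := by
    refine integral_congr_ae ?_
    filter_upwards [h2.coeFn_toLp] with x hx
    rw [hx]
  rw [← h4, h3]
  refine integral_congr_ae ?_
  filter_upwards [hae] with x hx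
  rw [hx]

end Plancherel

/-! ### The resolvent as a Laplace transform -/

section Laplace

open MeasureTheory FourierTransform

variable {E : Type*} [NormedAddCommGroup E] [InnerProductSpace ℂ E]

theorem IsUnitaryGroupOf.hasDerivAt {H : E →ₗ.[ℂ] E} {U : ℝ → E →L[ℂ] E}
    (hU : IsUnitaryGroupOf H U) (x : H.domain) (t : ℝ) :
    HasDerivAt (fun s => U s x) (-(Complex.I • U t (H x))) t := by
  have h0 : HasDerivAt (fun s : ℝ => U s x) (-(Complex.I • H x)) (t - t) := by
    rw [sub_self]
    exact (hU.generator x (H x)).1 ⟨x.2, rfl⟩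
  have h1 : HasDerivAt (fun s : ℝ => U (s - t) x) (-(Complex.I • H x)) t := h0.comp_sub_const t t
  have h2 := ((U t).restrictScalars ℝ).hasFDerivAt.comp_hasDerivAt t h1
  have e : (fun s => U s x) = ⇑((U t).restrictScalars ℝ) ∘ fun s : ℝ => U (s - t) x := by
    funext s
    have h3 := congrArg (fun A : E →L[ℂ] E => A x) (hU.map_add t (s - t))
    simpa using h3
  rw [e]
  convert h2 using 1
  simp

theorem IsUnitaryGroupOf.norm_inner_le {H : E →ₗ.[ℂ] E} {U : ℝ → E →L[ℂ] E}
    (hU : IsUnitaryGroupOf H U) (e ψ : E) (t : ℝ) : ‖inner ℂ e (U t ψ)‖ ≤ ‖e‖ * ‖ψ‖ := by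
  refine (norm_inner_le_norm _ _).trans_eq ?_
  rw [hU.norm_map]

/-- The matrix element of the damped evolution, for positive times. -/
def dampedOrbit (U : ℝ → E →L[ℂ] E) (ε : ℝ) (e ψ : E) : ℝ → ℂ :=
  Set.indicator (Set.Ioi 0) fun t => (Real.exp (-ε * t) : ℂ) * inner ℂ e (U t ψ)

theorem IsUnitaryGroupOf.integrable_dampedOrbit {H : E →ₗ.[ℂ] E} {U : ℝ → E →L[ℂ] E}
    (hU : IsUnitaryGroupOf H U) {ε : ℝ} (hε : 0 < ε) (e ψ : E) :
    Integrable (dampedOrbit U ε e ψ) := by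
  rw [dampedOrbit, integrable_indicator_iff measurableSet_Ioi]
  have hc := hU.continuous_orbit ψ
  have hcont : Continuous fun t => (Real.exp (-ε * t) : ℂ) * inner ℂ e (U t ψ) := by fun_prop
  refine Integrable.mono' ((exp_neg_integrableOn_Ioi 0 hε).mul_const (‖e‖ * ‖ψ‖))
    hcont.aestronglyMeasurable (Eventually.of_forall fun t => ?_)
  rw [norm_mul, Complex.norm_real, Real.norm_of_nonneg (Real.exp_pos _).le]
  gcongr
  exact hU.norm_inner_le e ψ t

theorem IsUnitaryGroupOf.memLp_dampedOrbit {H : E →ₗ.[ℂ] E} {U : ℝ → E →L[ℂ] E}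
    (hU : IsUnitaryGroupOf H U) {ε : ℝ} (hε : 0 < ε) (e ψ : E) :
    MemLp (dampedOrbit U ε e ψ) 2 := by
  have h1 := hU.integrable_dampedOrbit hε e ψ
  rw [memLp_two_iff_integrable_sq_norm h1.aestronglyMeasurable]
  refine Integrable.mono' (h1.norm.const_mul (‖e‖ * ‖ψ‖)) (h1.aestronglyMeasurable.norm.pow 2)
    (Eventually.of_forall fun t => ?_)
  rw [Real.norm_of_nonneg (by positivity), sq]
  gcongr
  by_cases ht : t ∈ Set.Ioi (0 : ℝ)
  · rw [dampedOrbit, Set.indicator_of_mem ht, norm_mul, Complex.norm_real,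
      Real.norm_of_nonneg (Real.exp_pos _).le]
    have h2 : Real.exp (-ε * t) ≤ 1 := by
      rw [Real.exp_le_one_iff]
      nlinarith [Set.mem_Ioi.1 ht]
    have h3 := hU.norm_inner_le e ψ t
    have := mul_le_mul h2 h3 (norm_nonneg _) zero_le_one
    linarith
  · rw [dampedOrbit, Set.indicator_of_notMem ht, norm_zero]
    positivity

/-- With `ψ = (H - z)φ`, the function `e^{izt}⟨e, U t φ⟩` has derivative `-i e^{izt}⟨e, U t ψ⟩` and
decays, so the integral is a boundary term at 0. The convention `e^{-2πiξt}` forces `Re z = -2πξ`.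
-/
theorem IsUnitaryGroupOf.fourier_dampedOrbit {H : E →ₗ.[ℂ] E} {U : ℝ → E →L[ℂ] E}
    (hU : IsUnitaryGroupOf H U) {ε : ℝ} (hε : 0 < ε) (e : E) (ξ : ℝ) {z : ℂ}
    (hz : z = (-(2 * Real.pi * ξ) : ℝ) + Complex.I * ε) (φ : H.domain) :
    𝓕 (dampedOrbit U ε e (H φ - z • (φ : E))) ξ = -(Complex.I * inner ℂ e (φ : E)) := by
  set ψ := H φ - z • (φ : E) with hψ
  have hexp : ∀ t : ℝ, HasDerivAt (fun t : ℝ => Complex.exp (Complex.I * z * t))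
      (Complex.exp (Complex.I * z * t) * (Complex.I * z)) t := by
    intro t
    have h := ((Complex.ofRealCLM.hasDerivAt (x := t)).const_mul (Complex.I * z)).cexp
    simpa using h
  have hnormexp : ∀ t : ℝ, ‖Complex.exp (Complex.I * z * t)‖ = Real.exp (-ε * t) := by
    intro t
    rw [Complex.norm_exp]
    congr 1
    simp [hz]
  have hderiv : ∀ t : ℝ, HasDerivAt
      (fun t : ℝ => Complex.exp (Complex.I * z * t) * inner ℂ e (U t φ))
      (-(Complex.I * (Complex.exp (Complex.I * z * t) * inner ℂ e (U t ψ)))) t := by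
    intro t
    have h1 := ((innerSL ℂ e).restrictScalars ℝ).hasFDerivAt.comp_hasDerivAt t (hU.hasDerivAt φ t)
    have h2 := (hexp t).mul h1
    refine h2.congr_deriv ?_
    simp [hψ, inner_smul_right, inner_neg_right]
    ring
  have hfourier : 𝓕 (dampedOrbit U ε e ψ) ξ =
      ∫ t in Set.Ioi (0 : ℝ), Complex.exp (Complex.I * z * t) * inner ℂ e (U t ψ) := by
    rw [Real.fourier_real_eq_integral_exp_smul, ← integral_indicator measurableSet_Ioi]
    refine integral_congr_ae (Eventually.of_forall fun t => ?_)
    by_cases ht : t ∈ Set.Ioi (0 : ℝ)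
    · simp only [dampedOrbit, Set.indicator_of_mem ht, smul_eq_mul]
      rw [← mul_assoc, Complex.ofReal_exp, ← Complex.exp_add]
      congr 2
      rw [hz]
      push_cast
      linear_combination (ε * t : ℂ) * (-Complex.I_sq)
    · simp [dampedOrbit, Set.indicator_of_notMem ht]
  have hint : IntegrableOn (fun t : ℝ => Complex.exp (Complex.I * z * t) * inner ℂ e (U t ψ))
      (Set.Ioi 0) := by
    have hc := hU.continuous_orbit ψ
    refine Integrable.mono' ((exp_neg_integrableOn_Ioi 0 hε).mul_const (‖e‖ * ‖ψ‖))
      (Continuous.aestronglyMeasurable (by fun_prop)) (Eventually.of_forall fun t => ?_)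
    rw [norm_mul, hnormexp]
    gcongr
    exact hU.norm_inner_le e ψ t
  have hlim : Tendsto (fun t : ℝ => Complex.exp (Complex.I * z * t) * inner ℂ e (U t φ)) atTop
      (𝓝 0) := by
    have h1 : Tendsto (fun t : ℝ => Real.exp (-ε * t) * (‖e‖ * ‖(φ : E)‖)) atTop (𝓝 0) := by
      have h2 : Tendsto (fun t : ℝ => Real.exp (-ε * t)) atTop (𝓝 0) :=
        Real.tendsto_exp_atBot.comp (tendsto_id.const_mul_atTop_of_neg (neg_neg_of_pos hε))
      simpa using h2.mul_const (‖e‖ * ‖(φ : E)‖)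
    refine squeeze_zero_norm (fun t => ?_) h1
    rw [norm_mul, hnormexp]
    gcongr
    exact hU.norm_inner_le e φ t
  have hFTC := integral_Ioi_of_hasDerivAt_of_tendsto' (a := 0) (fun t _ => hderiv t)
    ((hint.const_mul Complex.I).neg) hlim
  rw [integral_neg, integral_const_mul, ← hfourier] at hFTC
  have hzero : U 0 φ = (φ : E) := by rw [hU.map_zero]; rfl
  simp only [hzero, Complex.ofReal_zero, mul_zero, Complex.exp_zero, one_mul, zero_sub,
    neg_inj] at hFTC
  rw [← hFTC, ← mul_assoc, Complex.I_mul_I]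
  ring

end Laplace

section Final

open MeasureTheory FourierTransform

variable {a b : ℕ → ℝ}

/-! ### The Borel transform near the spectral measure -/

theorem im_borelTransform
    (μ : Measure ℝ) [IsFiniteMeasure μ] (e : ℝ) {ε : ℝ} (hε : 0 < ε) :
    Integrable (fun x : ℝ => ε / ((x - e) ^ 2 + ε ^ 2)) μ ∧
      (∫ x : ℝ, ((x : ℂ) - ((e : ℂ) + Complex.I * ε))⁻¹ ∂μ).im
        = ∫ x : ℝ, ε / ((x - e) ^ 2 + ε ^ 2) ∂μ := by
  have him : ∀ x : ℝ, (((x : ℂ) - ((e : ℂ) + Complex.I * ε))⁻¹).im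
      = ε / ((x - e) ^ 2 + ε ^ 2) := by
    intro x
    rw [Complex.inv_im, Complex.normSq_apply]
    simp
    ring_nf
  have hne : ∀ x : ℝ, (x : ℂ) - ((e : ℂ) + Complex.I * ε) ≠ 0 := by
    intro x h
    have := congrArg Complex.im h
    simp at this
    exact hε.ne' this
  have hint : Integrable (fun x : ℝ => ((x : ℂ) - ((e : ℂ) + Complex.I * ε))⁻¹) μ := by
    refine Integrable.mono' (integrable_const ε⁻¹) (Continuous.aestronglyMeasurable ?_)
      (Eventually.of_forall fun x => ?_)
    · exact Continuous.inv₀ (by fun_prop) hne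
    · rw [norm_inv]
      apply inv_anti₀ hε
      refine le_trans (le_of_eq ?_) (Complex.abs_im_le_norm _)
      simp [abs_of_pos hε]
  refine ⟨?_, ?_⟩
  · simpa only [Complex.imCLM_apply, him] using Complex.imCLM.integrable_comp hint
  · have := Complex.imCLM.integral_comp_comm hint
    simp only [Complex.imCLM_apply, him] at this
    exact this.symm

/-- The Poisson integral of `μ` over the `ε`-neighbourhood of a set dominates `μ` of the set. -/
theorem measure_le_lintegral_poisson (μ : Measure ℝ) [IsFiniteMeasure μ] (S : Set ℝ) {ε : ℝ}
    (hε : 0 < ε) :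
    ENNReal.ofReal (1 / (2 * Real.pi)) * μ S ≤
      ∫⁻ ξ in {ξ : ℝ | -(2 * Real.pi * ξ) ∈ Metric.thickening ε S},
        ∫⁻ x, ENNReal.ofReal (ε / ((x - -(2 * Real.pi * ξ)) ^ 2 + ε ^ 2)) ∂μ := by
  set A := {ξ : ℝ | -(2 * Real.pi * ξ) ∈ Metric.thickening ε S}
  have hcont : Continuous fun p : ℝ × ℝ => ε / ((p.2 - -(2 * Real.pi * p.1)) ^ 2 + ε ^ 2) :=
    Continuous.div (by fun_prop) (by fun_prop) fun p => by positivity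
  have hmeas : Measurable fun p : ℝ × ℝ =>
      ENNReal.ofReal (ε / ((p.2 - -(2 * Real.pi * p.1)) ^ 2 + ε ^ 2)) :=
    hcont.measurable.ennreal_ofReal
  rw [lintegral_lintegral_swap hmeas.aemeasurable]
  set f : ℝ → ENNReal := fun x => ∫⁻ ξ in A,
    ENNReal.ofReal (ε / ((x - -(2 * Real.pi * ξ)) ^ 2 + ε ^ 2))
  have hf : Measurable f := Measurable.lintegral_prod_left' (μ := volume.restrict A) hmeas
  have hlow : ∀ x ∈ S, ENNReal.ofReal (1 / (2 * Real.pi)) ≤ f x := by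
    intro x hx
    have hpi := Real.pi_pos
    -- On `B` the kernel is at least `1/(2ε)`, and `B` has length `ε/π`; the product is `1/(2π)`.
    set B := Metric.ball (-(x / (2 * Real.pi))) (ε / (2 * Real.pi))
    have hB : ∀ ξ ∈ B, |x - -(2 * Real.pi * ξ)| < ε := by
      intro ξ hξ
      rw [Metric.mem_ball, Real.dist_eq, lt_div_iff₀ (by positivity)] at hξ
      have e : x - -(2 * Real.pi * ξ) = (ξ - -(x / (2 * Real.pi))) * (2 * Real.pi) := by
        field_simp
        ring
      rw [e, abs_mul, abs_of_pos (show 0 < 2 * Real.pi by positivity)]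
      exact hξ
    have hBA : B ⊆ A := by
      intro ξ hξ
      rw [Set.mem_ofPred_eq, Metric.mem_thickening_iff]
      refine ⟨x, hx, ?_⟩
      rw [dist_comm, Real.dist_eq]
      exact hB ξ hξ
    calc ENNReal.ofReal (1 / (2 * Real.pi))
        = ENNReal.ofReal (1 / (2 * ε)) * volume B := by
          rw [Real.volume_ball, ← ENNReal.ofReal_mul (by positivity)]
          congr 1
          field_simp
      _ = ∫⁻ _ in B, ENNReal.ofReal (1 / (2 * ε)) := by rw [setLIntegral_const]
      _ ≤ ∫⁻ ξ in B, ENNReal.ofReal (ε / ((x - -(2 * Real.pi * ξ)) ^ 2 + ε ^ 2)) := by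
          refine setLIntegral_mono' Metric.isOpen_ball.measurableSet fun ξ hξ => ?_
          apply ENNReal.ofReal_le_ofReal
          rw [div_le_div_iff₀ (by positivity) (by positivity)]
          have h := sq_lt_sq' (neg_lt_of_abs_lt (hB ξ hξ)) (lt_of_abs_lt (hB ξ hξ))
          nlinarith
      _ ≤ f x := lintegral_mono_set hBA
  -- Markov's inequality for the measurable function `f`, which avoids measurability of `S`.
  calc ENNReal.ofReal (1 / (2 * Real.pi)) * μ S
      ≤ ENNReal.ofReal (1 / (2 * Real.pi)) * μ {x | ENNReal.ofReal (1 / (2 * Real.pi)) ≤ f x} := by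
        gcongr
        exact hlow
    _ ≤ ∫⁻ x, f x ∂μ := mul_meas_ge_le_lintegral hf _

/-! ### Time averages -/

theorem normSqL_site (u : ℕ → ℂ) {L : ℝ} (hL : 0 ≤ L) :
    normSqL (site u) L = ∑ i ∈ Finset.range (⌊L⌋₊ + 1), weight L i * ‖u i‖ ^ 2 :=
  normSqL_eq_sum _ hL (Nat.lt_succ_self _)

theorem indicator_exp_mul_normSqL (U : ℝ → HalfLine →L[ℂ] HalfLine) (ψ : HalfLine) (T : ℝ) {L : ℝ}
    (hL : 0 ≤ L) : (Set.Ioi (0 : ℝ)).indicator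
      (fun t => Real.exp (-2 * t / T) * normSqL (site (U t ψ)) L) =
    fun t => ∑ i ∈ Finset.range (⌊L⌋₊ + 1),
      weight L i * ‖dampedOrbit U T⁻¹ (delta i) ψ t‖ ^ 2 := by
  funext t
  by_cases ht : t ∈ Set.Ioi (0 : ℝ)
  · simp only [Set.indicator_of_mem ht, dampedOrbit, normSqL_site _ hL, inner_delta,
      Finset.mul_sum]
    refine Finset.sum_congr rfl fun i _ => ?_
    rw [norm_mul, Complex.norm_real, Real.norm_of_nonneg (Real.exp_pos _).le, mul_pow,
      ← Real.exp_nat_mul]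
    rw [show ((2 : ℕ) : ℝ) * (-T⁻¹ * t) = -2 * t / T by push_cast; ring]
    ring
  · simp [Set.indicator_of_notMem ht, dampedOrbit]

theorem integrableOn_exp_mul_normSqL {H : HalfLine →ₗ.[ℂ] HalfLine}
    {U : ℝ → HalfLine →L[ℂ] HalfLine} (hU : IsUnitaryGroupOf H U) (ψ : HalfLine) {T L : ℝ}
    (hT : 0 < T) (hL : 0 ≤ L) :
    IntegrableOn (fun t => Real.exp (-2 * t / T) * normSqL (site (U t ψ)) L) (Set.Ioi 0) := by
  rw [← integrable_indicator_iff measurableSet_Ioi, indicator_exp_mul_normSqL U ψ T hL]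
  exact integrable_finsetSum _ fun i _ =>
    ((hU.memLp_dampedOrbit (inv_pos.2 hT) (delta i) ψ).integrable_norm_pow two_ne_zero).const_mul _

/-- The time-averaged truncated norm, in terms of the Fourier transform of the evolution. -/
theorem timeAverage_eq_integral_fourier {H : HalfLine →ₗ.[ℂ] HalfLine}
    {U : ℝ → HalfLine →L[ℂ] HalfLine} (hU : IsUnitaryGroupOf H U) (ψ : HalfLine) {T L : ℝ}
    (hT : 0 < T) (hL : 0 ≤ L) :
    Integrable (fun ξ => ∑ i ∈ Finset.range (⌊L⌋₊ + 1),
        weight L i * ‖𝓕 (dampedOrbit U T⁻¹ (delta i) ψ) ξ‖ ^ 2) ∧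
    timeAverage T (fun t => normSqL (site (U t ψ)) L) =
      2 / T * ∫ ξ, ∑ i ∈ Finset.range (⌊L⌋₊ + 1),
        weight L i * ‖𝓕 (dampedOrbit U T⁻¹ (delta i) ψ) ξ‖ ^ 2 := by
  have hε : 0 < T⁻¹ := inv_pos.2 hT
  have hpl := fun i => plancherel (hU.integrable_dampedOrbit hε (delta i) ψ)
    (hU.memLp_dampedOrbit hε (delta i) ψ)
  have hsq := fun i => (hU.memLp_dampedOrbit hε (delta i) ψ).integrable_norm_pow two_ne_zero
  refine ⟨integrable_finsetSum _ fun i _ => (hpl i).1.const_mul _, ?_⟩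
  rw [integral_finsetSum _ fun i _ => (hpl i).1.const_mul _]
  simp only [integral_const_mul, (hpl _).2]
  rw [timeAverage]
  congr 1
  rw [← integral_indicator measurableSet_Ioi, indicator_exp_mul_normSqL U ψ T hL,
    integral_finsetSum _ fun i _ => (hsq i).const_mul _]
  simp only [integral_const_mul]

/-- Needed for strictness when the spectral measure of the set is 0. At `t = 0` all mass sits at the
site 1, which has full weight since `L > 1`. -/
theorem timeAverage_pos {H : HalfLine →ₗ.[ℂ] HalfLine}
    {U : ℝ → HalfLine →L[ℂ] HalfLine} (hU : IsUnitaryGroupOf H U) {T L : ℝ}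
    (hT : 0 < T) (hL : 1 < L) :
    0 < timeAverage T (fun t => normSqL (site (U t delta1)) L) := by
  have hL0 : 0 ≤ L := by linarith
  have hcoord : ∀ i, Continuous fun t => U t delta1 i := by
    intro i
    simp only [← inner_delta]
    have := hU.continuous_orbit delta1
    fun_prop
  have hc : Continuous fun t => Real.exp (-2 * t / T) * normSqL (site (U t delta1)) L := by
    simp only [normSqL_site _ hL0]
    have : Continuous fun t => ∑ i ∈ Finset.range (⌊L⌋₊ + 1), weight L i * ‖U t delta1 i‖ ^ 2 :=
      continuous_finsetSum _ fun i _ => ((hcoord i).norm.pow 2).const_mul _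
    fun_prop
  have hnn : ∀ t, 0 ≤ Real.exp (-2 * t / T) * normSqL (site (U t delta1)) L := fun t =>
    mul_nonneg (Real.exp_pos _).le (normSqL_nonneg _ hL0)
  have hint := integrableOn_exp_mul_normSqL hU delta1 hT hL0
  have h0 : 0 < Real.exp (-2 * 0 / T) * normSqL (site (U 0 delta1)) L := by
    refine mul_pos (Real.exp_pos _) ?_
    have h := sum_range_le_normSqL (site (U 0 delta1)) (N := 1) (L := L) (by simpa using hL.le)
    have h1 : U 0 delta1 = delta 0 := by rw [hU.map_zero]; rfl
    rw [h1] at h ⊢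
    simp [site, delta_apply] at h
    linarith
  rw [timeAverage]
  refine mul_pos (by positivity) ?_
  rw [setIntegral_pos_iff_support_of_nonneg_ae (Eventually.of_forall hnn) hint]
  have hnear := hc.continuousAt.eventually (lt_mem_nhds h0)
  obtain ⟨δ, hδ, hball⟩ := Metric.eventually_nhds_iff.1 hnear
  refine lt_of_lt_of_le ?_ (measure_mono (s := Set.Ioo 0 δ) fun t ht => ⟨?_, ht.1⟩)
  · simpa using hδ
  · refine (hball ?_).ne'
    rw [Real.dist_eq, sub_zero, abs_of_pos ht.1]
    exact ht.2

theorem spectralMeasure_le_timeAverage (h0 : a 0 = 1) (ha : ∀ n, a n ≠ 0)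
    (hsum : ¬ Summable fun n => |a n|⁻¹) {U : ℝ → HalfLine →L[ℂ] HalfLine}
    (hU : IsUnitaryGroupOf (halfLineOp a b) U) {μ : Measure ℝ}
    (hμ : IsSpectralMeasure (halfLineOp a b) delta1 μ) {T L : ℝ} (hT : 0 < T) (hL : 0 ≤ L) :
    μ.real {E : ℝ | lengthScale a b T⁻¹ E ≤ L} ≤
      9 * Real.pi * timeAverage T (fun t => normSqL (site (U t delta1)) L) := by
  have := hμ.finite
  have hε : 0 < T⁻¹ := inv_pos.2 hT
  set S := {E : ℝ | lengthScale a b T⁻¹ E ≤ L}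
  set A := {ξ : ℝ | -(2 * Real.pi * ξ) ∈ Metric.thickening T⁻¹ S} with hA
  obtain ⟨hint, htime⟩ := timeAverage_eq_integral_fourier hU delta1 hT hL
  set F : ℝ → ℝ := fun ξ => ∑ i ∈ Finset.range (⌊L⌋₊ + 1),
    weight L i * ‖𝓕 (dampedOrbit U T⁻¹ (delta i) delta1) ξ‖ ^ 2 with hF
  have hFnn : ∀ ξ, 0 ≤ F ξ := fun ξ =>
    Finset.sum_nonneg fun i _ => mul_nonneg (weight_nonneg L i) (by positivity)
  have hbound : ∀ ξ ∈ A, ENNReal.ofReal (T / 9) *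
      ∫⁻ x, ENNReal.ofReal (T⁻¹ / ((x - -(2 * Real.pi * ξ)) ^ 2 + T⁻¹ ^ 2)) ∂μ
        ≤ ENNReal.ofReal (F ξ) := by
    intro ξ hξ
    set e := -(2 * Real.pi * ξ) with he
    obtain ⟨E, hE, hdist⟩ := Metric.mem_thickening_iff.1 hξ
    obtain ⟨φ, hφ, hborel⟩ := hμ.borelTransform ((e : ℂ) + Complex.I * (T⁻¹ : ℝ)) (by
      simpa using hT.ne')
    -- Both `|e - E|` and `Im z` are at most `1/T`.
    have hz : ‖(e : ℂ) + Complex.I * (T⁻¹ : ℝ) - E‖ ^ 2 ≤ 2 / T ^ 2 := by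
      rw [← Complex.normSq_eq_norm_sq, Complex.normSq_apply]
      have h1 : ((e : ℂ) + Complex.I * (T⁻¹ : ℝ) - E).re = e - E := by simp
      have h2 : ((e : ℂ) + Complex.I * (T⁻¹ : ℝ) - E).im = T⁻¹ := by simp
      rw [Real.dist_eq] at hdist
      have h3 := sq_lt_sq' (neg_lt_of_abs_lt hdist) (lt_of_abs_lt hdist)
      have h4 : 2 / T ^ 2 = 2 * T⁻¹ ^ 2 := by field_simp
      rw [h1, h2, h4]
      linarith
    have hmain := im_resolvent_le_normSqL h0 ha hsum hT hE hz hφ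
    have hFeq : normSqL (site (φ : HalfLine)) L = F ξ := by
      rw [normSqL_site _ hL]
      refine Finset.sum_congr rfl fun i _ => ?_
      have h := hU.fourier_dampedOrbit hε (delta i) ξ rfl φ
      rw [hφ] at h
      rw [h, norm_neg, norm_mul, Complex.norm_I, one_mul, inner_delta]
    obtain ⟨hpint, him⟩ := im_borelTransform μ e hε
    rw [← delta_zero, inner_delta] at hborel
    rw [← hborel] at him
    rw [← ofReal_integral_eq_lintegral_ofReal hpint
      (Eventually.of_forall fun x => by positivity), ← him,
      ← ENNReal.ofReal_mul (by positivity)]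
    apply ENNReal.ofReal_le_ofReal
    rw [← hFeq]
    exact (mul_le_mul_of_nonneg_left (le_abs_self _) (by positivity)).trans hmain
  -- `A` is open whether or not `S` is measurable, so the pointwise bound may be integrated over it.
  have hmeasA : MeasurableSet A :=
    (Metric.isOpen_thickening.preimage (by fun_prop :
      Continuous fun ξ : ℝ => -(2 * Real.pi * ξ))).measurableSet
  have hchain : ENNReal.ofReal (T / 9) * (ENNReal.ofReal (1 / (2 * Real.pi)) * μ S)
      ≤ ENNReal.ofReal (∫ ξ, F ξ) := by
    calc _ ≤ ENNReal.ofReal (T / 9) * ∫⁻ ξ in A,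
          ∫⁻ x, ENNReal.ofReal (T⁻¹ / ((x - -(2 * Real.pi * ξ)) ^ 2 + T⁻¹ ^ 2)) ∂μ := by
          gcongr
          exact measure_le_lintegral_poisson μ S hε
      _ = ∫⁻ ξ in A, ENNReal.ofReal (T / 9) *
          ∫⁻ x, ENNReal.ofReal (T⁻¹ / ((x - -(2 * Real.pi * ξ)) ^ 2 + T⁻¹ ^ 2)) ∂μ := by
          rw [lintegral_const_mul' _ _ ENNReal.ofReal_ne_top]
      _ ≤ ∫⁻ ξ in A, ENNReal.ofReal (F ξ) := setLIntegral_mono' hmeasA hbound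
      _ ≤ ∫⁻ ξ, ENNReal.ofReal (F ξ) := setLIntegral_le_lintegral _ _
      _ = ENNReal.ofReal (∫ ξ, F ξ) :=
          (ofReal_integral_eq_lintegral_ofReal hint (Eventually.of_forall hFnn)).symm
  have hreal := ENNReal.toReal_mono ENNReal.ofReal_ne_top hchain
  rw [ENNReal.toReal_mul, ENNReal.toReal_mul, ENNReal.toReal_ofReal (by positivity),
    ENNReal.toReal_ofReal (by positivity), ENNReal.toReal_ofReal (integral_nonneg hFnn)] at hreal
  rw [htime, measureReal_def]
  have hpi := Real.pi_pos
  calc (μ S).toReal = 18 * Real.pi / T * (T / 9 * (1 / (2 * Real.pi) * (μ S).toReal)) := by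
        field_simp; ring
    _ ≤ 18 * Real.pi / T * ∫ ξ, F ξ := by gcongr
    _ = _ := by ring

end Final

end JacobiDynamics

end

theorem theorem1p1 :
    ∃ C : ℝ, 0 < C ∧
      ∀ (a b : ℕ → ℝ), a 0 = 1 → (∀ n, a n ≠ 0) → ¬ Summable (fun n => |a n|⁻¹) →
        ∀ (T L : ℝ), 0 < T → 1 < L →
          JacobiDynamics.timeAverage T
              (fun t => JacobiDynamics.normSqL
                (JacobiDynamics.site
                  (JacobiDynamics.propagator (JacobiDynamics.halfLineOp a b) t
                    JacobiDynamics.delta1)) L)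
            > C * (JacobiDynamics.spectralMeasure (JacobiDynamics.halfLineOp a b)
                JacobiDynamics.delta1).real
                {E : ℝ | JacobiDynamics.lengthScale a b T⁻¹ E ≤ L} := by
  -- Room below `1/(9π)`: the bound `π < 4` already gives `1/36`.
  refine ⟨1 / 100, by norm_num, fun a b h0 ha hsum T L hT hL => ?_⟩
  have hU := JacobiDynamics.isUnitaryGroupOf_propagator (b := b) ha hsum
  have hle := JacobiDynamics.spectralMeasure_le_timeAverage h0 ha hsum hU
    (JacobiDynamics.isSpectralMeasure_spectralMeasure ha hsum JacobiDynamics.delta1) hT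
    (zero_le_one.trans hL.le)
  have hpos := JacobiDynamics.timeAverage_pos hU hT hL
  have hpi : Real.pi < 4 := Real.pi_lt_four
  have hmul := mul_lt_mul_of_pos_right hpi hpos
  linarith
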